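/- Let $\mathcal C$ be a combinatorial model category, and let $\Sigma$ be the category obtained from $\Delta\times\Delta$ by adding a new terminal object $[-1]$. Write $(k,\ell)$ for $([k],[\ell])$. A preaugmented bisimplicial object in $\mathcal C$ is a functor $Y\colon\Sigma^{\mathrm{op}}\to\mathcal C$, with values $Y_{k,\ell}$ and $Y_{-1}$. It is injectively fibrant if $Y\to *$ has the right lifting property against all levelwise acyclic cofibrations in $\mathcal C^{\Sigma^{\mathrm{op}}}$. Let $s^h,t^h\colon(k,0)\to(k,\ell)$ be the identity in the first component and $0\mapsto 0$, respectively $0\mapsto\ell$, in the second; let $s^v,t^v\colon(0,\ell)\to(k,\ell)$ be $0\mapsto0$, respectively $0\mapsto k$, in the first component and the identity in the second. The induced maps of $Y$ are denoted by the same symbols, and $\times^h$ denotes homotopy pullbacks. The object $Y$ is an augmented stable double Segal object if the following hold. 1. (Double Segal) For all $q,r\ge1$ the maps induced by the inclusions of the spines, $$Y_{q,r}\to \underbrace{Y_{q,1}\times^h_{Y_{q,0}}\cdots\times^h_{Y_{q,0}}Y_{q,1}}_{r},\qquad Y_{q,r}\to \underbrace{Y_{1,r}\times^h_{Y_{0,r}}\cdots\times^h_{Y_{0,r}}Y_{1,r}}_{q},$$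 are weak equivalences. 2. (Stable) The maps $Y_{0,1}\times^h_{Y_{0,0}}Y_{1,0}\leftarrow Y_{1,1}\to Y_{1,0}\times^h_{Y_{0,0}}Y_{0,1}$, the first induced by the sources $s^v,s^h$ and the second by the targets $t^h,t^v$, are weak equivalences. 3. (Augmented) The composites $$Y_{1,0}\;{}^{t^v}\!\!\times^h_{Y_{0,0}}Y_{-1}\xrightarrow{\mathrm{pr}_1}Y_{1,0}\xrightarrow{s^v}Y_{0,0},\qquad Y_{0,1}\;{}^{s^h}\!\!\times^h_{Y_{0,0}}Y_{-1}\xrightarrow{\mathrm{pr}_1}Y_{0,1}\xrightarrow{t^h}Y_{0,0}$$ are weak equivalences. The initial path construction of $Y$ is the preaugmented bisimplicial object $P^{\triangleleft}Y$ whose underlying bisimplicial object is the composite of that of $Y$ with $([0]\star-)\times\mathrm{id}$, so that $(P^{\triangleleft}Y)_{q,r}=Y_{1+q,r}$; whose value at $[-1]$ is the (strict) pullback $(P^{\triangleleft}Y)_{-1}=Y_{1,0}\times_{Y_{0,0}}Y_{-1}$ along $t^v\colon Y_{1,0}\to Y_{0,0}$; and whose map $(P^{\triangleleft}Y)_{-1}\to(P^{\triangleleft}Y)_{0,0}=Y_{1,0}$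 is the first projection. If $Y$ is an injectively fibrant augmented stable double Segal object in $\mathcal C$, then $P^{\triangleleft}Y$ is an augmented stable double Segal object in $\mathcal C$. -/

import Mathlib

open CategoryTheory Limits HomotopicalAlgebra Opposite

universe w v u v₁ u₁

namespace DoubleSegal

noncomputable section

/-! ### Combinatorial model categories, injective fibrancy, homotopy limits -/

/-- A model category is combinatorial (with respect to the universe `w` of small sets) if its
underlying category is locally presentable and it is cofibrantly generated: there are small sets
`I` of generating cofibrations and `J` of generating trivial cofibrations. (In a locally
presentable category every small set of morphisms permits the small object argument.) -/
class IsCombinatorial (C : Type u) [Category.{v} C] [ModelCategory C] : Prop where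
  locallyPresentable : IsLocallyPresentable.{w} C
  exists_generating_cofibrations :
    ∃ I : MorphismProperty C, MorphismProperty.IsSmall.{w} I ∧ trivialFibrations C = I.rlp
  exists_generating_trivialCofibrations :
    ∃ J : MorphismProperty C, MorphismProperty.IsSmall.{w} J ∧ fibrations C = J.rlp

/-- A diagram `F : J ⥤ C` is injectively fibrant if the map from `F` to the terminal diagram has
the right lifting property against all levelwise trivial cofibrations, i.e. if `F` is a fibrant
object of the injective model structure on `J ⥤ C`. -/
def IsInjectivelyFibrant {C : Type u} [Category.{v} C] [ModelCategory C]
    {J : Type u₁} [Category.{v₁} J] (F : J ⥤ C) : Prop :=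
  ((trivialCofibrations C).functorCategory J).rlp (terminal.from F)

/-- An injectively fibrant replacement of a diagram: a levelwise weak equivalence to an
injectively fibrant diagram. -/
structure FibrantReplacement {C : Type u} [Category.{v} C] [ModelCategory C]
    {J : Type u₁} [Category.{v₁} J] (F : J ⥤ C) where
  /-- the replacing diagram -/
  diagram : J ⥤ C
  /-- the levelwise weak equivalence -/
  ι : F ⟶ diagram
  weakEquivalence (j : J) : WeakEquivalence (ι.app j)
  fibrant : IsInjectivelyFibrant diagram

/-- The cone `c` over `F` is a homotopy limit cone, i.e. the canonical map from its apex to the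
homotopy limit of `F` is a weak equivalence. The homotopy limit of `F` is the limit of an
injectively fibrant replacement of `F`. -/
def IsHomotopyLimit {C : Type u} [Category.{v} C] [ModelCategory C]
    {J : Type u₁} [Category.{v₁} J] {F : J ⥤ C} (c : Cone F) : Prop :=
  ∃ (R : FibrantReplacement F) (l : Cone R.diagram) (hl : IsLimit l),
    WeakEquivalence (hl.lift ((Cone.postcompose R.ι).obj c))

/-! ### Segal objects -/

/-- The shape `e₀ → v₁ ← e₁ → v₂ ← ⋯ → vₘ ← eₘ` of an `(m + 1)`-fold fibre product. -/
abbrev spineShape (m : ℕ) : MulticospanShape where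
  L := Fin (m + 1)
  R := Fin m
  fst := Fin.castSucc
  snd := Fin.succ

/-- The diagram `X₁ → X₀ ← X₁ → ⋯ ← X₁` with `m + 1` copies of `X₁` whose limit is the iterated
fibre product `X₁ ×_{X₀} ⋯ ×_{X₀} X₁`: the target of each edge is matched with the source of the
next one. -/
abbrev spineIndex {C : Type u} [Category.{v} C] (X : SimplicialObject C) (m : ℕ) :
    MulticospanIndex (spineShape m) C where
  left _ := X.obj (op (SimplexCategory.mk 1))
  right _ := X.obj (op (SimplexCategory.mk 0))
  fst _ := X.map (SimplexCategory.δ (n := 0) 0).op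
  snd _ := X.map (SimplexCategory.δ (n := 0) 1).op

/-- The cone `X_{m+1} → X₁ ×_{X₀} ⋯ ×_{X₀} X₁` induced by the inclusion of the spine into the
standard `(m + 1)`-simplex. -/
def spineCone {C : Type u} [Category.{v} C] (X : SimplicialObject C) (m : ℕ) :
    Multifork (spineIndex X m) :=
  Multifork.ofι (spineIndex X m) (X.obj (op (SimplexCategory.mk (m + 1))))
    (fun i => X.map (SimplexCategory.mkOfSucc (n := m + 1) i).op)
    (fun b => by
      change X.map (SimplexCategory.mkOfSucc (n := m + 1) b.castSucc).op ≫
          X.map (SimplexCategory.δ (n := 0) 0).op =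
        X.map (SimplexCategory.mkOfSucc (n := m + 1) b.succ).op ≫
          X.map (SimplexCategory.δ (n := 0) 1).op
      rw [← X.map_comp, ← X.map_comp, ← op_comp, ← op_comp, SimplexCategory.δ_zero_mkOfSucc,
        SimplexCategory.δ_one_mkOfSucc, Fin.succ_castSucc])

/-- The `n`-th Segal map `Xₙ → X₁ ×ʰ_{X₀} ⋯ ×ʰ_{X₀} X₁`, for `n = m + 1`, is a weak equivalence. -/
def SegalMapIsWeakEquivalence {C : Type u} [Category.{v} C] [ModelCategory C]
    (X : SimplicialObject C) (m : ℕ) : Prop :=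
  IsHomotopyLimit (spineCone X m)

/-! ### Bisimplicial objects -/

/-- The object `([k], [l])` of `Δ × Δ`. -/
abbrev bi (k l : ℕ) : SimplexCategory × SimplexCategory :=
  (SimplexCategory.mk k, SimplexCategory.mk l)

/-- `sʰ : (k, 0) ⟶ (k, l)`, given by `0 ↦ 0` in the second component. -/
abbrev sh (k l : ℕ) : bi k 0 ⟶ bi k l :=
  Prod.mkHom (𝟙 (SimplexCategory.mk k))
    (SimplexCategory.const (SimplexCategory.mk 0) (SimplexCategory.mk l) 0)

/-- `tʰ : (k, 0) ⟶ (k, l)`, given by `0 ↦ l` in the second component. -/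
abbrev th (k l : ℕ) : bi k 0 ⟶ bi k l :=
  Prod.mkHom (𝟙 (SimplexCategory.mk k))
    (SimplexCategory.const (SimplexCategory.mk 0) (SimplexCategory.mk l) (Fin.last l))

/-- `sᵛ : (0, l) ⟶ (k, l)`, given by `0 ↦ 0` in the first component. -/
abbrev sv (k l : ℕ) : bi 0 l ⟶ bi k l :=
  Prod.mkHom (SimplexCategory.const (SimplexCategory.mk 0) (SimplexCategory.mk k) 0)
    (𝟙 (SimplexCategory.mk l))

/-- `tᵛ : (0, l) ⟶ (k, l)`, given by `0 ↦ k` in the first component. -/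
abbrev tv (k l : ℕ) : bi 0 l ⟶ bi k l :=
  Prod.mkHom (SimplexCategory.const (SimplexCategory.mk 0) (SimplexCategory.mk k) (Fin.last k))
    (𝟙 (SimplexCategory.mk l))

/-- A bisimplicial object of `C`. -/
abbrev BisimplicialObject (C : Type u) [Category.{v} C] : Type (max v u) :=
  (SimplexCategory × SimplexCategory)ᵒᵖ ⥤ C

/-- The simplicial object `Z_{•,r}`. -/
abbrev fixSnd {C : Type u} [Category.{v} C] (Z : BisimplicialObject C) (r : ℕ) :
    SimplicialObject C :=
  (Prod.sectL SimplexCategory (SimplexCategory.mk r)).op ⋙ Z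

/-- The simplicial object `Z_{q,•}`. -/
abbrev fixFst {C : Type u} [Category.{v} C] (Z : BisimplicialObject C) (q : ℕ) :
    SimplicialObject C :=
  (Prod.sectR (SimplexCategory.mk q) SimplexCategory).op ⋙ Z

/-- A bisimplicial object `Z` is double Segal if for all `q, r ≥ 1` (here `q = a + 1` and
`r = b + 1`) the maps `Z_{q,r} → Z_{q,1} ×ʰ_{Z_{q,0}} ⋯ ×ʰ_{Z_{q,0}} Z_{q,1}` (`r` factors) and
`Z_{q,r} → Z_{1,r} ×ʰ_{Z_{0,r}} ⋯ ×ʰ_{Z_{0,r}} Z_{1,r}` (`q` factors) are weak equivalences. -/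
def IsDoubleSegal {C : Type u} [Category.{v} C] [ModelCategory C]
    (Z : BisimplicialObject C) : Prop :=
  ∀ a b : ℕ, SegalMapIsWeakEquivalence (fixFst Z (a + 1)) b ∧
    SegalMapIsWeakEquivalence (fixSnd Z (b + 1)) a

/-- The cone `Z_{0,1} ← Z_{1,1} → Z_{1,0}` over `Z_{0,1} → Z_{0,0} ← Z_{1,0}` given by the
sources. -/
def spanCone {C : Type u} [Category.{v} C] (Z : BisimplicialObject C) :
    PullbackCone (Z.map (sh 0 1).op) (Z.map (sv 1 0).op) :=
  PullbackCone.mk (Z.map (sv 1 1).op) (Z.map (sh 1 1).op) (by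
    rw [← Z.map_comp, ← Z.map_comp, ← op_comp, ← op_comp]
    congr 2)

/-- The cone `Z_{1,0} ← Z_{1,1} → Z_{0,1}` over `Z_{1,0} → Z_{0,0} ← Z_{0,1}` given by the
targets. -/
def cospanCone {C : Type u} [Category.{v} C] (Z : BisimplicialObject C) :
    PullbackCone (Z.map (tv 1 0).op) (Z.map (th 0 1).op) :=
  PullbackCone.mk (Z.map (th 1 1).op) (Z.map (tv 1 1).op) (by
    rw [← Z.map_comp, ← Z.map_comp, ← op_comp, ← op_comp]
    congr 2)

/-- Stability: the maps `Z_{0,1} ×ʰ_{Z_{0,0}} Z_{1,0} ← Z_{1,1} → Z_{1,0} ×ʰ_{Z_{0,0}} Z_{0,1}`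
induced by sources and by targets are weak equivalences. -/
def IsStable {C : Type u} [Category.{v} C] [ModelCategory C]
    (Z : BisimplicialObject C) : Prop :=
  IsHomotopyLimit (spanCone Z) ∧ IsHomotopyLimit (cospanCone Z)

/-! ### Preaugmented bisimplicial objects -/

/-- The category `Σ`, obtained from `Δ × Δ` by adding a new terminal object `[-1]`. -/
abbrev SigmaCat : Type := WithTerminal (SimplexCategory × SimplexCategory)

/-- A preaugmented bisimplicial object of `C` is a functor `Σᵒᵖ ⥤ C`. -/
abbrev PreaugmentedBisimplicialObject (C : Type u) [Category.{v} C] : Type (max v u) :=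
  SigmaCatᵒᵖ ⥤ C

/-- The underlying bisimplicial object `i^* Y`. -/
abbrev underlying {C : Type u} [Category.{v} C] (Y : PreaugmentedBisimplicialObject C) :
    BisimplicialObject C :=
  (WithTerminal.incl (C := SimplexCategory × SimplexCategory)).op ⋙ Y

/-- The object `Y_{-1}`. -/
abbrev minusOne {C : Type u} [Category.{v} C] (Y : PreaugmentedBisimplicialObject C) : C :=
  Y.obj (op WithTerminal.star)

/-- The map `Y_{-1} ⟶ Y_{0,0}`. -/
abbrev augmentation {C : Type u} [Category.{v} C] (Y : PreaugmentedBisimplicialObject C) :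
    minusOne Y ⟶ (underlying Y).obj (op (bi 0 0)) :=
  Y.map (WithTerminal.homFrom (bi 0 0)).op

/-- For morphisms `f : A ⟶ B`, `g : D ⟶ B` and `h : A ⟶ E`, the composite
`A ×ʰ_B D → A → E` of the first projection and `h` is a weak equivalence.

Here `A ×ʰ_B D` is the limit of an injectively fibrant replacement `A' → B' ← D'` of the cospan
`A → B ← D`. Its first projection lands in `A'` rather than in `A`, so `h` is represented by a map
`h' : A' ⟶ E'` which is identified with `h` by the weak equivalences `A ⟶ A'` and
`σ : E ⟶ E'`. -/
def ProjectionThenIsWeakEquivalence {C : Type u} [Category.{v} C] [ModelCategory C]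
    {A B D E : C} (f : A ⟶ B) (g : D ⟶ B) (h : A ⟶ E) : Prop :=
  ∃ (R : FibrantReplacement (cospan f g)) (l : Cone R.diagram) (_ : IsLimit l)
    (E' : C) (σ : E ⟶ E') (h' : R.diagram.obj WalkingCospan.left ⟶ E'),
    WeakEquivalence σ ∧ R.ι.app WalkingCospan.left ≫ h' = h ≫ σ ∧
      WeakEquivalence (l.π.app WalkingCospan.left ≫ h')

/-- A preaugmented bisimplicial object `Y` satisfies the augmentation condition if the composites
`Y_{1,0} ×ʰ_{Y_{0,0}} Y_{-1} → Y_{1,0} → Y_{0,0}` (homotopy pullback along `tᵛ`, followed by `sᵛ`)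
and `Y_{0,1} ×ʰ_{Y_{0,0}} Y_{-1} → Y_{0,1} → Y_{0,0}` (homotopy pullback along `sʰ`, followed by
`tʰ`) are weak equivalences. -/
def IsAugmented {C : Type u} [Category.{v} C] [ModelCategory C]
    (Y : PreaugmentedBisimplicialObject C) : Prop :=
  ProjectionThenIsWeakEquivalence ((underlying Y).map (tv 1 0).op) (augmentation Y)
      ((underlying Y).map (sv 1 0).op) ∧
    ProjectionThenIsWeakEquivalence ((underlying Y).map (sh 0 1).op) (augmentation Y)
      ((underlying Y).map (th 0 1).op)

/-- Augmented stable double Segal objects. -/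
structure IsAugmentedStableDoubleSegal {C : Type u} [Category.{v} C] [ModelCategory C]
    (Y : PreaugmentedBisimplicialObject C) : Prop where
  doubleSegal : IsDoubleSegal (underlying Y)
  stable : IsStable (underlying Y)
  augmented : IsAugmented Y

/-! ### The initial path construction -/

/-- The map `[0] ⋆ f : [0] ⋆ [m] ⟶ [0] ⋆ [n]`: `0 ↦ 0` and `i + 1 ↦ f i + 1`. -/
def joinMap {x y : SimplexCategory} (f : x ⟶ y) :
    SimplexCategory.mk (x.len + 1) ⟶ SimplexCategory.mk (y.len + 1) :=
  SimplexCategory.mkHom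
    { toFun := Fin.cases 0 (fun i => (f.toOrderHom i).succ)
      monotone' := by
        intro a b hab
        induction a using Fin.cases with
        | zero => exact Fin.zero_le _
        | succ a =>
          induction b using Fin.cases with
          | zero => exact absurd hab (by simp)
          | succ b =>
            simpa using f.toOrderHom.monotone (Fin.succ_le_succ_iff.mp hab) }

/-- The functor `Δ ⥤ Δ`, `[n] ↦ [0] ⋆ [n] = [1 + n]`. -/
def join : SimplexCategory ⥤ SimplexCategory where
  obj x := SimplexCategory.mk (x.len + 1)
  map f := joinMap f
  map_id x := by
    ext i : 3
    induction i using Fin.cases <;> rfl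
  map_comp f g := by
    ext i : 3
    induction i using Fin.cases <;> rfl

/-- The unique morphism from an object of `Δ × Δ` to the terminal object `(0, 0)`. -/
abbrev toZero (x : SimplexCategory × SimplexCategory) : x ⟶ bi 0 0 :=
  Prod.mkHom (SimplexCategory.const x.1 (SimplexCategory.mk 0) 0)
    (SimplexCategory.const x.2 (SimplexCategory.mk 0) 0)

/-- The bisimplicial object `(q, r) ↦ Z_{1+q,r}`, the composite of `Z` with `j × id`. -/
abbrev pathBisimplicial {C : Type u} [Category.{v} C] (Z : BisimplicialObject C) :
    BisimplicialObject C :=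
  (join.prod (𝟭 SimplexCategory)).op ⋙ Z

/-- The object `Y_{1,0} ×_{Y_{0,0}} Y_{-1}`, a strict pullback, where `Y_{1,0} ⟶ Y_{0,0}` is the
vertical target `tᵛ`. -/
abbrev pathMinusOne {C : Type u} [Category.{v} C] [HasPullbacks C]
    (Y : PreaugmentedBisimplicialObject C) : C :=
  pullback ((underlying Y).map (tv 1 0).op) (augmentation Y)

/-- The first projection `Y_{1,0} ×_{Y_{0,0}} Y_{-1} ⟶ Y_{1,0} = (P^◁ Y)_{0,0}`. -/
def pathAugmentation {C : Type u} [Category.{v} C] [HasPullbacks C]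
    (Y : PreaugmentedBisimplicialObject C) :
    pathMinusOne Y ⟶ (pathBisimplicial (underlying Y)).obj (op (bi 0 0)) :=
  pullback.fst ((underlying Y).map (tv 1 0).op) (augmentation Y)

/-- The initial path construction `P^◁ Y`: its underlying bisimplicial object is
`(q, r) ↦ Y_{1+q,r}`, its value at `[-1]` is `Y_{1,0} ×_{Y_{0,0}} Y_{-1}`, and the map from the
latter to `(P^◁ Y)_{0,0} = Y_{1,0}` is the first projection. The maps to the other
`(P^◁ Y)_{q,r}` are then forced, since `(q, r) ⟶ [-1]` factors through `(0, 0)`. -/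
def initialPath {C : Type u} [Category.{v} C] [HasPullbacks C]
    (Y : PreaugmentedBisimplicialObject C) : PreaugmentedBisimplicialObject C :=
  (WithTerminal.lift (Z := op (pathMinusOne Y)) (pathBisimplicial (underlying Y)).rightOp
    (fun x => (pathAugmentation Y ≫ (pathBisimplicial (underlying Y)).map (toZero x).op).op)
    (fun x y f => by
      apply Quiver.Hom.unop_inj
      have h : (toZero y).op ≫ f.op = (toZero x).op := rfl
      change (pathAugmentation Y ≫ (pathBisimplicial (underlying Y)).map (toZero y).op) ≫
        (pathBisimplicial (underlying Y)).map f.op =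
          pathAugmentation Y ≫ (pathBisimplicial (underlying Y)).map (toZero x).op
      rw [Category.assoc, ← (pathBisimplicial (underlying Y)).map_comp, h])).leftOp

end

end DoubleSegal

/-! ### Base change of weak equivalences between fibrant objects -/

/-! Injective fibrancy turns every homotopy limit in the statement into a strict limit up to weak
equivalence; the theorem then follows by pasting squares.

If f : x ⟶ y is an epimorphism of the index category, Hom(y, -) is a subfunctor of Hom(x, -).
Lifting against Hom(x, -) ⊗ A ∪ Hom(y, -) ⊗ B ⟶ Hom(x, -) ⊗ B shows that an injectively fibrant
diagram sends f to a fibration (`IsInjectivelyFibrant.fibration_map`). So all values of Y are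
fibrant, and pairs of monomorphisms of Δ act by fibrations. Right properness is not available, so
base change of weak equivalences along fibrations is proved between fibrant objects. Cogluing then
identifies homotopy limits of cospans and of spines with strict ones
(`isHomotopyLimit_iff_isHoPullback`, `isHomotopyLimit_constSpine_iff`). The resulting squares,
`IsHoPullback`, can be pasted and cancelled (`IsHoPullback.paste_horiz_iff`).

The Segal maps of X are all weak equivalences iff the squares X_{m+2} ~ X_{m+1} ×_{X_0} X_1 are
homotopy pullbacks. Cancelling X_2 ~ X_1 ×_{X_0} X_1 from such a square of X gives the corresponding
square of the décalage. Stability of the path construction comes from pasting Y_{2,1} ~ Y_{1,1}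
×_{Y_{0,1}} Y_{1,1} with the stability squares of Y and cancelling Y_{2,0} ~ Y_{1,0} ×_{Y_{0,0}}
Y_{1,0}. The latter lies in column 0, where no Segal condition is assumed, but column 0 is a retract
of column 1 (`SegalSquare.fixSnd_zero`). Finally, each augmentation composite of the path
construction is, up to weak equivalence, the base change along tᵛ of an augmentation equivalence of
Y (`weakEquivalence_fst_comp_of_isHoPullback`). -/

namespace DoubleSegal

section BaseChange

variable {C : Type u} [Category.{v} C] [ModelCategory C]

/-- Pulling back a trivial fibration over a base gives a weak equivalence. -/
lemma weakEquivalence_of_isPullback_trivialFibration {P P' X Y Y' Z : C} {a : P ⟶ X} {b : P ⟶ Y}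
    {a' : P' ⟶ X} {b' : P' ⟶ Y'} {f : X ⟶ Z} {q : Y ⟶ Z} {q' : Y' ⟶ Z} (h : IsPullback a b f q)
    (h' : IsPullback a' b' f q') (e : Y ⟶ Y') [Fibration e] [WeakEquivalence e] (he : e ≫ q' = q)
    (φ : P ⟶ P') (h₁ : φ ≫ a' = a) (h₂ : φ ≫ b' = b ≫ e) : WeakEquivalence φ := by
  subst he h₁
  have sq : IsPullback b φ e b' := IsPullback.of_bot h.flip h₂.symm h'.flip
  rw [weakEquivalence_iff]
  exact (MorphismProperty.of_isPullback sq (mem_trivialFibrations e)).2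

lemma exists_isPullback {X Y Z : C} (f : X ⟶ Z) (g : Y ⟶ Z) :
    ∃ (P : C) (a : P ⟶ X) (b : P ⟶ Y), IsPullback a b f g :=
  ⟨_, _, _, IsPullback.of_hasPullback f g⟩

lemma fibration_fst_of_isPullback {P X Y Z : C} {a : P ⟶ X} {b : P ⟶ Y} {f : X ⟶ Z} {g : Y ⟶ Z}
    (h : IsPullback a b f g) [Fibration g] : Fibration a := by
  rw [fibration_iff]
  exact MorphismProperty.of_isPullback h.flip (mem_fibrations g)

lemma weakEquivalence_fst_of_isPullback_trivialFibration {P X Y Z : C} {a : P ⟶ X} {b : P ⟶ Y}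
    {f : X ⟶ Z} {g : Y ⟶ Z} (h : IsPullback a b f g) [Fibration g] [WeakEquivalence g] :
    WeakEquivalence a := by
  rw [weakEquivalence_iff]
  exact (MorphismProperty.of_isPullback h.flip (mem_trivialFibrations g)).2

/-- A weak equivalence between fibrations over `Z` stays a weak equivalence after pulling back
along any morphism `X ⟶ Z`. -/
lemma weakEquivalence_of_isPullback_fibrations {P P' X Y Y' Z : C} {a : P ⟶ X} {b : P ⟶ Y}
    {a' : P' ⟶ X} {b' : P' ⟶ Y'} {f : X ⟶ Z} {q : Y ⟶ Z} {q' : Y' ⟶ Z} (h : IsPullback a b f q)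
    (h' : IsPullback a' b' f q') [Fibration q] [Fibration q'] (e : Y ⟶ Y') [WeakEquivalence e]
    (he : e ≫ q' = q)
    (φ : P ⟶ P') (h₁ : φ ≫ a' = a) (h₂ : φ ≫ b' = b ≫ e) : WeakEquivalence φ := by
  obtain ⟨R, y, y', hR⟩ := exists_isPullback q q'
  have := fibration_fst_of_isPullback hR
  have := fibration_fst_of_isPullback hR.flip
  -- Ken Brown's argument in the slice over Z: factoring the graph of e in Y ×_Z Y' gives trivial
  -- fibrations u, u' with F.i a section of u and e = F.i ≫ u'. Trivial fibrations pull back along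
  -- anything, so neither X nor Z has to be fibrant.
  let F := MorphismProperty.factorizationData (trivialCofibrations C) (fibrations C)
    (hR.lift (𝟙 Y) e (by simp [he]))
  let u : F.Z ⟶ Y := F.p ≫ y
  let u' : F.Z ⟶ Y' := F.p ≫ y'
  have hu : F.i ≫ u = 𝟙 Y := by simp [u]
  have hu' : F.i ≫ u' = e := by simp [u']
  have huu : u' ≫ q' = u ≫ q := by simp [u, u', hR.w]
  have : WeakEquivalence u := weakEquivalence_of_precomp_of_fac hu
  have : WeakEquivalence u' := weakEquivalence_of_precomp_of_fac hu'
  have : Fibration u := by dsimp [u]; infer_instance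
  have : Fibration u' := by dsimp [u']; infer_instance
  obtain ⟨Q, c, d, hQ⟩ := exists_isPullback f (u ≫ q)
  let π : Q ⟶ P := h.lift c (d ≫ u) (by simp [hQ.w])
  let π' : Q ⟶ P' := h'.lift c (d ≫ u') (by simp [hQ.w, huu])
  have : WeakEquivalence π := weakEquivalence_of_isPullback_trivialFibration hQ h u rfl π
    (by simp [π]) (by simp [π])
  have : WeakEquivalence π' := weakEquivalence_of_isPullback_trivialFibration hQ h' u' huu π'
    (by simp [π']) (by simp [π'])
  let s : P ⟶ Q := hQ.lift a (b ≫ F.i) (by rw [Category.assoc, reassoc_of% hu, h.w])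
  have hs : s ≫ π = 𝟙 P := h.hom_ext (by simp [s, π]) (by simp [s, π, hu])
  have : WeakEquivalence s := weakEquivalence_of_postcomp_of_fac hs
  have hφ : φ = s ≫ π' :=
    h'.hom_ext (by simp [s, π', h₁]) (by simp [s, π', hu', h₂])
  rw [hφ]
  infer_instance

/-- Pulling back, along a fibration, a trivial cofibration that has a retraction. -/
lemma weakEquivalence_snd_of_trivialCofibration {P X Q E : C} {a : P ⟶ X} {j : P ⟶ E}
    {i : X ⟶ Q} {g : E ⟶ Q} (h : IsPullback a j i g) [IsFibrant Q]
    [Cofibration i] [WeakEquivalence i] [Fibration g] (r : Q ⟶ X) (hr : i ≫ r = 𝟙 X) :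
    WeakEquivalence j := by
  obtain ⟨L, hL⟩ := PathObject.exists_very_good Q
  have sq : CommSq (i ≫ L.ι) i L.p (prod.lift (𝟙 Q) (r ≫ i)) := ⟨by
    apply Limits.prod.hom_ext
    · rw [Category.assoc, Category.assoc, L.p_fst, Category.assoc, prod.lift_fst]; simp
    · rw [Category.assoc, Category.assoc, L.p_snd, Category.assoc, prod.lift_snd]
      simp [reassoc_of% hr]⟩
  -- A deformation of Q from the identity to r ≫ i, constant on X.
  let H : Q ⟶ L.P := sq.lift
  have hi : i ≫ H = i ≫ L.ι := sq.fac_left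
  have hH : H ≫ L.p = prod.lift (𝟙 Q) (r ≫ i) := sq.fac_right
  have h0 : H ≫ L.p₀ = 𝟙 Q := by rw [← L.p_fst, reassoc_of% hH, prod.lift_fst]
  have h1 : H ≫ L.p₁ = r ≫ i := by rw [← L.p_snd, reassoc_of% hH, prod.lift_snd]
  -- N is the object of points of E with a path in Q starting below them, and M adds a point of E
  -- above the end. Factoring E ⟶ M gives a path object F.Z of E, with n a trivial fibration: paths
  -- of Q lift once a starting point is given.
  obtain ⟨N, N₁, N₂, hN⟩ := exists_isPullback g L.p₀
  obtain ⟨M, M₁, M₂, hM⟩ := exists_isPullback (N₂ ≫ L.p₁) g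
  have := fibration_fst_of_isPullback hM
  have := fibration_fst_of_isPullback hN
  have := weakEquivalence_fst_of_isPullback_trivialFibration hN
  let c : E ⟶ N := hN.lift (𝟙 E) (g ≫ L.ι) (by simp)
  let F := MorphismProperty.factorizationData (trivialCofibrations C) (fibrations C)
    (hM.lift c (𝟙 E) (by simp [c]))
  let n : F.Z ⟶ N := F.p ≫ M₁
  let z₀ : F.Z ⟶ E := n ≫ N₁
  let z₁ : F.Z ⟶ E := F.p ≫ M₂
  have hn : F.i ≫ n = c := by simp [n]
  have hz₀ : F.i ≫ z₀ = 𝟙 E := by simp only [z₀, reassoc_of% hn]; simp [c]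
  have hz₁ : F.i ≫ z₁ = 𝟙 E := by simp [z₁]
  have : WeakEquivalence z₀ := weakEquivalence_of_precomp_of_fac hz₀
  have : WeakEquivalence z₁ := weakEquivalence_of_precomp_of_fac hz₁
  have : WeakEquivalence n := weakEquivalence_of_postcomp_of_fac (rfl : n ≫ N₁ = z₀)
  have : Fibration n := by dsimp [n]; infer_instance
  have hz : z₁ ≫ g = n ≫ N₂ ≫ L.p₁ := by simp [z₁, n, hM.w]
  let k : E ⟶ N := hN.lift (𝟙 E) (g ≫ H) (by simp [h0])
  -- W consists of the lifts to E of the paths of H, and e₁ takes their endpoints. These lie over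
  -- the image of r ≫ i, which yields ρ. Since H is constant on X, points of P have constant lifts,
  -- which yields κ. Thus j is a retract of the weak equivalence e₁.
  obtain ⟨W, W₁, W₂, hW⟩ := exists_isPullback k n
  have := weakEquivalence_fst_of_isPullback_trivialFibration hW
  have hw : W₂ ≫ z₀ = W₁ := by simp [z₀, ← reassoc_of% hW.w, k]
  have : WeakEquivalence W₂ := weakEquivalence_of_postcomp_of_fac hw
  let e₁ : W ⟶ E := W₂ ≫ z₁
  have he₁ : W₁ ≫ g ≫ r ≫ i = e₁ ≫ g := by
    simp only [e₁, Category.assoc, hz, ← reassoc_of% hW.w]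
    simp [k, h1]
  have : WeakEquivalence e₁ := by dsimp only [e₁]; infer_instance
  let ρ : W ⟶ P := h.lift (W₁ ≫ g ≫ r) e₁ (by simpa using he₁)
  let κ : P ⟶ W := hW.lift j (j ≫ F.i) (by
    rw [Category.assoc, hn]
    apply hN.hom_ext
    · simp [k, c]
    · simp [k, c, ← reassoc_of% h.w, hi])
  have hκ : κ ≫ e₁ = j := by simp [κ, e₁, hz₁]
  have hρ : ρ ≫ j = e₁ := by simp [ρ]
  have hκρ : κ ≫ ρ = 𝟙 P := h.hom_ext (by simp [κ, ρ, ← reassoc_of% h.w, hr]) (by simp [hρ, hκ])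
  let R : RetractArrow j e₁ :=
    { i := Arrow.homMk κ (𝟙 E) (by simp [hκ])
      r := Arrow.homMk ρ (𝟙 E) (by simp [hρ])
      retract := by ext <;> simp [hκρ] }
  rw [weakEquivalence_iff]
  exact MorphismProperty.of_retract R (mem_weakEquivalences e₁)

/-- The pullback of a weak equivalence between fibrant objects along a fibration is a weak
equivalence. -/
lemma weakEquivalence_snd_of_isPullback {P X Y Z : C} {a : P ⟶ X} {b : P ⟶ Y} {f : X ⟶ Z}
    {g : Y ⟶ Z} (h : IsPullback a b f g) [IsFibrant X] [IsFibrant Z] [Fibration g]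
    [WeakEquivalence f] : WeakEquivalence b := by
  -- Brown factorization writes f as a trivial cofibration with a retraction followed by a trivial
  -- fibration; the two factors are base changed separately.
  obtain ⟨F⟩ : Nonempty (FibrantBrownFactorization f) := inferInstance
  have : Fibration F.p := by simpa only [fibration_iff] using F.hp
  obtain ⟨_, _⟩ := (mem_trivialCofibrations_iff _).1 F.hi
  have : IsFibrant F.Z := isFibrant_of_fibration F.p
  obtain ⟨R, R₁, R₂, hR⟩ := exists_isPullback F.p g
  have := fibration_fst_of_isPullback hR
  let j : P ⟶ R := hR.lift (a ≫ F.i) b (by simp [h.w])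
  have hj : IsPullback a j F.i R₁ :=
    (IsPullback.of_right (by simpa [j] using h.flip) (by simp [j]) hR.flip).flip
  have := weakEquivalence_snd_of_trivialCofibration hj F.r F.i_r
  have := weakEquivalence_fst_of_isPullback_trivialFibration hR.flip
  have hb : b = j ≫ R₂ := by simp [j]
  rw [hb]
  infer_instance

/-- The cogluing lemma. -/
lemma weakEquivalence_of_isPullback_of_isPullback {P X Y Z P' X' Y' Z' : C}
    {a : P ⟶ X} {b : P ⟶ Y} {f : X ⟶ Z} {g : Y ⟶ Z} (h : IsPullback a b f g)
    {a' : P' ⟶ X'} {b' : P' ⟶ Y'} {f' : X' ⟶ Z'} {g' : Y' ⟶ Z'} (h' : IsPullback a' b' f' g')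
    [IsFibrant X] [IsFibrant Z] [IsFibrant X'] [IsFibrant Z'] [Fibration g] [Fibration g']
    (x : X ⟶ X') (y : Y ⟶ Y') (z : Z ⟶ Z') [WeakEquivalence x] [WeakEquivalence y]
    [WeakEquivalence z] (hf : x ≫ f' = f ≫ z) (hg : y ≫ g' = g ≫ z) (φ : P ⟶ P')
    (ha : φ ≫ a' = a ≫ x) (hb : φ ≫ b' = b ≫ y) : WeakEquivalence φ := by
  obtain ⟨R, R₁, R₂, hR⟩ := exists_isPullback z g'
  have := fibration_fst_of_isPullback hR
  have : WeakEquivalence R₂ := weakEquivalence_snd_of_isPullback hR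
  let e : Y ⟶ R := hR.lift g y hg.symm
  have : WeakEquivalence e := weakEquivalence_of_postcomp_of_fac (hR.lift_snd g y hg.symm)
  -- S = X ×_{X'} P' is also X ×_{Z'} Y', hence X ×_Z R. Then P ⟶ S is the pullback of e, a weak
  -- equivalence of fibrations over Z, and S ⟶ P' is the base change of x along a fibration.
  obtain ⟨S, S₁, S₂, hS⟩ := exists_isPullback x a'
  have := fibration_fst_of_isPullback h'
  have : WeakEquivalence S₂ := weakEquivalence_snd_of_isPullback hS
  have hS' : IsPullback S₁ (S₂ ≫ b') (f ≫ z) g' := by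
    rw [← hf]
    exact (hS.flip.paste_horiz h'.flip).flip
  let m : S ⟶ R := hR.lift (S₁ ≫ f) (S₂ ≫ b') (by simpa using hS'.w)
  have hm : IsPullback S₁ m f R₁ :=
    (IsPullback.of_right (by simpa [m] using hS'.flip) (by simp [m]) hR.flip).flip
  let ψ : P ⟶ S := hS.lift a φ ha.symm
  have : WeakEquivalence ψ := weakEquivalence_of_isPullback_fibrations h hm e (by simp [e]) ψ
    (by simp [ψ]) (by
      apply hR.hom_ext
      · simp [ψ, m, e, h.w]
      · simp [ψ, m, e, hb])
  have hφ : φ = ψ ≫ S₂ := by simp [ψ]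
  rw [hφ]
  infer_instance

end BaseChange

/-! ### Squares whose comparison map to the strict pullback is a weak equivalence -/

section

variable {C : Type u} [Category.{v} C] [ModelCategory C]

/-- The comparison map from `P` to the strict pullback of `f` and `g` is a weak equivalence. This
is the notion of homotopy pullback square when `f` or `g` is a fibration between fibrant
objects. -/
def IsHoPullback {P X Y Z : C} (fst : P ⟶ X) (snd : P ⟶ Y) (f : X ⟶ Z) (g : Y ⟶ Z) : Prop :=
  ∃ (R : C) (a : R ⟶ X) (b : R ⟶ Y) (φ : P ⟶ R),
    IsPullback a b f g ∧ φ ≫ a = fst ∧ φ ≫ b = snd ∧ WeakEquivalence φ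

namespace IsHoPullback

variable {P X Y Z : C} {fst : P ⟶ X} {snd : P ⟶ Y} {f : X ⟶ Z} {g : Y ⟶ Z}

lemma w (h : IsHoPullback fst snd f g) : fst ≫ f = snd ≫ g := by
  obtain ⟨R, a, b, φ, hR, rfl, rfl, -⟩ := h
  simp [hR.w]

lemma of_isPullback (h : IsPullback fst snd f g) : IsHoPullback fst snd f g :=
  ⟨P, fst, snd, 𝟙 P, h, by simp, by simp, inferInstance⟩

lemma flip (h : IsHoPullback fst snd f g) : IsHoPullback snd fst g f := by
  obtain ⟨R, a, b, φ, hR, h₁, h₂, h₃⟩ := h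
  exact ⟨R, b, a, φ, hR.flip, h₂, h₁, h₃⟩

lemma weakEquivalence (h : IsHoPullback fst snd f g) {R : C} {a : R ⟶ X} {b : R ⟶ Y}
    (hR : IsPullback a b f g) (φ : P ⟶ R) (ha : φ ≫ a = fst) (hb : φ ≫ b = snd) :
    WeakEquivalence φ := by
  obtain ⟨R', a', b', φ', hR', ha', hb', _⟩ := h
  have : φ = φ' ≫ (hR'.isoIsPullback _ _ hR).hom :=
    hR.hom_ext (by simp [ha, ha']) (by simp [hb, hb'])
  rw [this]
  infer_instance

lemma weakEquivalence_fst (h : IsHoPullback fst snd f g) [IsFibrant Y] [IsFibrant Z]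
    [Fibration f] [WeakEquivalence g] : WeakEquivalence fst := by
  obtain ⟨R, a, b, φ, hR, rfl, rfl, _⟩ := h
  have := weakEquivalence_snd_of_isPullback hR.flip
  infer_instance

/-- Pasting of homotopy pullback squares. -/
lemma paste_horiz_iff {X₁₁ X₁₂ X₁₃ X₂₁ X₂₂ X₂₃ : C} {h₁₁ : X₁₁ ⟶ X₁₂} {h₁₂ : X₁₂ ⟶ X₁₃}
    {h₂₁ : X₂₁ ⟶ X₂₂} {h₂₂ : X₂₂ ⟶ X₂₃} {v₁₁ : X₁₁ ⟶ X₂₁} {v₁₂ : X₁₂ ⟶ X₂₂} {v₁₃ : X₁₃ ⟶ X₂₃}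
    [Fibration v₁₂] [Fibration v₁₃] (h : IsHoPullback h₁₂ v₁₂ v₁₃ h₂₂)
    (hw : h₁₁ ≫ v₁₂ = v₁₁ ≫ h₂₁) :
    IsHoPullback (h₁₁ ≫ h₁₂) v₁₁ v₁₃ (h₂₁ ≫ h₂₂) ↔ IsHoPullback h₁₁ v₁₁ v₁₂ h₂₁ := by
  obtain ⟨R, a, b, φ, hR, rfl, rfl, _⟩ := h
  have := fibration_fst_of_isPullback hR.flip
  obtain ⟨S, c, d, hS⟩ := exists_isPullback (φ ≫ b) h₂₁
  obtain ⟨T, e, k, hT⟩ := exists_isPullback b h₂₁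
  have hT' := hT.paste_horiz hR
  -- ψ is the pullback along h₂₁ of φ, a weak equivalence between fibrations over X₂₂; pasting
  -- reduces to two-out-of-three for α and ψ.
  let ψ : S ⟶ T := hT.lift (c ≫ φ) d (by simp [hS.w])
  have : WeakEquivalence ψ := weakEquivalence_of_isPullback_fibrations hS.flip hT.flip φ rfl ψ
    (by simp [ψ]) (by simp [ψ])
  let α : X₁₁ ⟶ S := hS.lift h₁₁ v₁₁ hw
  constructor
  · intro hP
    have : WeakEquivalence (α ≫ ψ) :=
      hP.weakEquivalence hT' _ (by simp [α, ψ]) (by simp [α, ψ])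
    exact ⟨S, c, d, α, hS, by simp [α], by simp [α], weakEquivalence_of_postcomp α ψ⟩
  · intro hP
    have : WeakEquivalence α := hP.weakEquivalence hS _ (by simp [α]) (by simp [α])
    exact ⟨T, _, _, α ≫ ψ, hT', by simp [α, ψ], by simp [α, ψ], inferInstance⟩

lemma paste_vert_iff {X₁₁ X₁₂ X₂₁ X₂₂ X₃₁ X₃₂ : C} {h₁₁ : X₁₁ ⟶ X₁₂} {h₂₁ : X₂₁ ⟶ X₂₂}
    {h₃₁ : X₃₁ ⟶ X₃₂} {v₁₁ : X₁₁ ⟶ X₂₁} {v₁₂ : X₁₂ ⟶ X₂₂} {v₂₁ : X₂₁ ⟶ X₃₁} {v₂₂ : X₂₂ ⟶ X₃₂}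
    [Fibration h₂₁] [Fibration h₃₁] (h : IsHoPullback h₂₁ v₂₁ v₂₂ h₃₁)
    (hw : h₁₁ ≫ v₁₂ = v₁₁ ≫ h₂₁) :
    IsHoPullback h₁₁ (v₁₁ ≫ v₂₁) (v₁₂ ≫ v₂₂) h₃₁ ↔ IsHoPullback h₁₁ v₁₁ v₁₂ h₂₁ :=
  ⟨fun hP => ((paste_horiz_iff h.flip hw.symm).1 hP.flip).flip,
    fun hP => ((paste_horiz_iff h.flip hw.symm).2 hP.flip).flip⟩

/-- A retract of a homotopy pullback square is a homotopy pullback square. -/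
lemma of_retract (h : IsHoPullback fst snd f g) {P' X' Y' Z' : C} {fst' : P' ⟶ X'}
    {snd' : P' ⟶ Y'} {f' : X' ⟶ Z'} {g' : Y' ⟶ Z'} (w' : fst' ≫ f' = snd' ≫ g')
    (p : Retract P' P) (x : Retract X' X) (y : Retract Y' Y) (z : Retract Z' Z)
    (i₁ : p.i ≫ fst = fst' ≫ x.i) (i₂ : p.i ≫ snd = snd' ≫ y.i)
    (i₃ : x.i ≫ f = f' ≫ z.i) (i₄ : y.i ≫ g = g' ≫ z.i)
    (r₁ : p.r ≫ fst' = fst ≫ x.r) (r₂ : p.r ≫ snd' = snd ≫ y.r)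
    (r₃ : x.r ≫ f' = f ≫ z.r) (r₄ : y.r ≫ g' = g ≫ z.r) :
    IsHoPullback fst' snd' f' g' := by
  obtain ⟨R, a, b, φ, hR, rfl, rfl, _⟩ := h
  obtain ⟨S, c, d, hS⟩ := exists_isPullback f' g'
  let ψ : P' ⟶ S := hS.lift fst' snd' w'
  let I : S ⟶ R := hR.lift (c ≫ x.i) (d ≫ y.i) (by simp [i₃, i₄, reassoc_of% hS.w])
  let J : R ⟶ S := hS.lift (a ≫ x.r) (b ≫ y.r) (by simp [r₃, r₄, reassoc_of% hR.w])
  let ρ : RetractArrow ψ φ :=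
    { i := Arrow.homMk p.i I (hR.hom_ext (by simp [I, ψ, i₁]) (by simp [I, ψ, i₂]))
      r := Arrow.homMk p.r J (hS.hom_ext (by simp [J, ψ, r₁]) (by simp [J, ψ, r₂]))
      retract := by
        ext
        · simp
        · exact hS.hom_ext (by simp [I, J]) (by simp [I, J]) }
  refine ⟨S, c, d, ψ, hS, by simp [ψ], by simp [ψ], ?_⟩
  rw [weakEquivalence_iff]
  exact MorphismProperty.of_retract ρ (mem_weakEquivalences φ)

end IsHoPullback

/-- The abstract form of the argument by which the augmentation condition passes to the path
construction. -/
lemma weakEquivalence_fst_comp_of_isHoPullback {U A A' B D E E' K : C} {u₁ u₃ : U ⟶ A}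
    {u₂ : U ⟶ A'} {t : A ⟶ B} {m n : A' ⟶ B} {g : D ⟶ B} {p : E ⟶ A} {q : E ⟶ D} {p' : E' ⟶ A'}
    {q' : E' ⟶ D} {k : K ⟶ U} {l : K ⟶ E} [Fibration u₂] [Fibration t] [IsFibrant E']
    [IsFibrant B] (hU : IsHoPullback u₃ u₂ t n) (hw : u₁ ≫ t = u₂ ≫ m) (hE : IsPullback p q t g)
    (hE' : IsPullback p' q' m g) [WeakEquivalence (p' ≫ n)] (hK : IsPullback k l u₁ p) :
    WeakEquivalence (k ≫ u₃) := by
  -- Through A, the object K is U ×_B D; since u₁ ≫ t = u₂ ≫ m it can be recomputed through A' as U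
  -- ×_{A'} E'. Pasting with `hU` exhibits k ≫ u₃ as the homotopy base change of p' ≫ n along t.
  have h₁ : IsPullback (l ≫ q) k g (u₂ ≫ m) := by
    rw [← hw]
    exact hK.flip.paste_horiz hE.flip
  let s : K ⟶ E' := hE'.lift (k ≫ u₂) (l ≫ q) (by simpa using h₁.w.symm)
  have h₂ : IsPullback s k p' u₂ :=
    IsPullback.of_right (h₁₂ := q') (by simpa [s] using h₁) (by simp [s]) hE'.flip
  have h₃ := (IsHoPullback.paste_horiz_iff hU h₂.flip.w).2 (IsHoPullback.of_isPullback h₂.flip)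
  exact h₃.weakEquivalence_fst

end

/-! ### Injectively fibrant diagrams -/

section

variable {C : Type u} [Category.{v} C] {J : Type u₁} [Category.{v₁} J]

section

variable [ModelCategory C]

lemma isInjectivelyFibrant_iff (F : J ⥤ C) :
    IsInjectivelyFibrant F ↔ ∀ ⦃G H : J ⥤ C⦄ (i : G ⟶ H)
      (_ : ∀ j, trivialCofibrations C (i.app j)) (a : G ⟶ F), ∃ l : H ⟶ F, i ≫ l = a := by
  constructor
  · intro hF G H i hi a
    have := hF i hi
    have sq : CommSq a i (terminal.from F) (terminal.from H) := ⟨Subsingleton.elim _ _⟩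
    exact ⟨sq.lift, sq.fac_left⟩
  · intro hF G H i hi
    refine ⟨fun {a b} sq => ?_⟩
    obtain ⟨l, hl⟩ := hF i hi a
    exact ⟨⟨{ l := l, fac_left := hl, fac_right := Subsingleton.elim _ _ }⟩⟩

lemma fibration_of_forall_exists_lift {X Y : C} (p : X ⟶ Y)
    (h : ∀ ⦃A B : C⦄ (i : A ⟶ B), trivialCofibrations C i → ∀ (a : A ⟶ X) (b : B ⟶ Y),
      a ≫ p = i ≫ b → ∃ l : B ⟶ X, i ≫ l = a ∧ l ≫ p = b) : Fibration p := by
  rw [fibration_iff, ← trivialCofibrations_rlp]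
  intro A B i hi
  refine ⟨fun {a b} sq => ?_⟩
  obtain ⟨l, hl, hl'⟩ := h i hi a b sq.w
  exact ⟨⟨{ l := l, fac_left := hl, fac_right := hl' }⟩⟩

end

/-- The source of `i : A ⟶ B` at `false`, its target at `true`. -/
def endpoint {A B : C} (_ : A ⟶ B) : Bool → C
  | false => A
  | true => B

/-- The maps `𝟙 A`, `i` and `𝟙 B` between the endpoints of `i : A ⟶ B`. -/
def endpointMap {A B : C} (i : A ⟶ B) : ∀ p q : Bool, p ≤ q → (endpoint i p ⟶ endpoint i q)
  | false, false, _ => 𝟙 A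
  | false, true, _ => i
  | true, true, _ => 𝟙 B

lemma endpointMap_self {A B : C} (i : A ⟶ B) (p : Bool) (h : p ≤ p) :
    endpointMap i p p h = 𝟙 _ := by
  cases p <;> rfl

lemma endpointMap_comp {A B : C} (i : A ⟶ B) (p q r : Bool) (h : p ≤ q) (h' : q ≤ r) :
    endpointMap i p q h ≫ endpointMap i q r h' = endpointMap i p r (h.trans h') := by
  cases p <;> cases q <;> cases r <;>
    first
    | exact absurd h (by decide)
    | exact absurd h' (by decide)
    | exact Category.id_comp _
    | exact Category.comp_id _

lemma trivialCofibrations_endpointMap [ModelCategory C] {A B : C} (i : A ⟶ B) (hi : trivialCofibrations C i)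
    (p q : Bool) (h : p ≤ q) : trivialCofibrations C (endpointMap i p q h) := by
  cases p <;> cases q
  · exact MorphismProperty.id_mem _ _
  · exact hi
  · exact absurd h (by decide)
  · exact MorphismProperty.id_mem _ _

-- The copowers Hom(x, j) ⊗ A below are then finite coproducts.
variable [∀ x y : J, Finite (x ⟶ y)]

/-- For a subfunctor `S` of the functor corepresented by `x`, given by its characteristic
functions `χ`, and `i : A ⟶ B`, this is the union of `Hom(x, -) ⊗ A` and `S ⊗ B` in
`Hom(x, -) ⊗ B`. -/
noncomputable def corepresentableUnion [HasFiniteCoproducts C] {x : J} (χ : ∀ j, (x ⟶ j) → Bool)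
    (hχ : ∀ ⦃j k : J⦄ (φ : x ⟶ j) (ψ : j ⟶ k), χ j φ ≤ χ k (φ ≫ ψ)) {A B : C} (i : A ⟶ B) :
    J ⥤ C where
  obj j := ∐ fun φ : x ⟶ j => endpoint i (χ j φ)
  map {j k} ψ := Sigma.desc fun φ =>
    endpointMap i _ _ (hχ φ ψ) ≫ Sigma.ι (fun φ : x ⟶ k => endpoint i (χ k φ)) (φ ≫ ψ)
  map_id j := by
    refine Sigma.hom_ext _ _ fun φ => ?_
    have : ∀ (φ' : x ⟶ j) (_ : φ' = φ) (h' : χ j φ ≤ χ j φ'),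
      endpointMap i _ _ h' ≫ Sigma.ι (fun φ : x ⟶ j => endpoint i (χ j φ)) φ' =
        Sigma.ι (fun φ : x ⟶ j => endpoint i (χ j φ)) φ := by
      rintro _ rfl h'
      rw [endpointMap_self, Category.id_comp]
    rw [Sigma.ι_desc, this _ (Category.comp_id φ), Category.comp_id]
  map_comp {j k l} ψ ψ' := by
    refine Sigma.hom_ext _ _ fun φ => ?_
    have : ∀ (φ' : x ⟶ l) (_ : φ' = (φ ≫ ψ) ≫ ψ') (h' : χ j φ ≤ χ l φ')
        (h'' : χ j φ ≤ χ l ((φ ≫ ψ) ≫ ψ')),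
      endpointMap i _ _ h' ≫ Sigma.ι (fun φ : x ⟶ l => endpoint i (χ l φ)) φ' =
        endpointMap i _ _ h'' ≫ Sigma.ι (fun φ : x ⟶ l => endpoint i (χ l φ)) _ := by
      rintro _ rfl _ _
      rfl
    rw [Sigma.ι_desc, Sigma.ι_desc_assoc, Category.assoc, Sigma.ι_desc]
    rw [this _ (Category.assoc _ _ _).symm _ ((hχ φ ψ).trans (hχ (φ ≫ ψ) ψ')),
      ← endpointMap_comp i _ _ _ (hχ φ ψ) (hχ (φ ≫ ψ) ψ'), Category.assoc]

namespace corepresentableUnion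

variable [HasFiniteCoproducts C] {x : J} (χ : ∀ j, (x ⟶ j) → Bool)
    (hχ : ∀ ⦃j k : J⦄ (φ : x ⟶ j) (ψ : j ⟶ k), χ j φ ≤ χ k (φ ≫ ψ)) {A B : C} (i : A ⟶ B)

/-- The inclusion of a summand. -/
noncomputable def ι {j : J} (φ : x ⟶ j) :
    endpoint i (χ j φ) ⟶ (corepresentableUnion χ hχ i).obj j :=
  Sigma.ι (fun φ : x ⟶ j => endpoint i (χ j φ)) φ

lemma ι_map {j k : J} (φ : x ⟶ j) (ψ : j ⟶ k) :
    ι χ hχ i φ ≫ (corepresentableUnion χ hχ i).map ψ =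
      endpointMap i _ _ (hχ φ ψ) ≫ ι χ hχ i (φ ≫ ψ) :=
  Sigma.ι_desc _ _

/-- Natural transformations out of `corepresentableUnion χ hχ i`. -/
noncomputable def desc {F : J ⥤ C} (e : ∀ {j : J} (φ : x ⟶ j), endpoint i (χ j φ) ⟶ F.obj j)
    (he : ∀ {j k : J} (φ : x ⟶ j) (ψ : j ⟶ k),
      endpointMap i _ _ (hχ φ ψ) ≫ e (φ ≫ ψ) = e φ ≫ F.map ψ) :
    corepresentableUnion χ hχ i ⟶ F where
  app j := Sigma.desc fun φ : x ⟶ j => e φ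
  naturality j k ψ := by
    refine Sigma.hom_ext _ _ fun φ => ?_
    dsimp only [corepresentableUnion]
    rw [Sigma.ι_desc_assoc, Category.assoc, Sigma.ι_desc, Sigma.ι_desc_assoc, he]

lemma ι_desc_app {F : J ⥤ C} (e : ∀ {j : J} (φ : x ⟶ j), endpoint i (χ j φ) ⟶ F.obj j)
    (he : ∀ {j k : J} (φ : x ⟶ j) (ψ : j ⟶ k),
      endpointMap i _ _ (hχ φ ψ) ≫ e (φ ≫ ψ) = e φ ≫ F.map ψ) {j : J} (φ : x ⟶ j) :
    ι χ hχ i φ ≫ (desc χ hχ i e he).app j = e φ :=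
  Sigma.ι_desc _ _

end corepresentableUnion

variable [ModelCategory C]

/-- By Yoneda this is lifting against Hom(x, -) ⊗ A ∪ S ⊗ B ⟶ Hom(x, -) ⊗ B, which at each level is
a coproduct of copies of i and of identities, hence a trivial cofibration. -/
lemma IsInjectivelyFibrant.exists_extension {F : J ⥤ C} (hF : IsInjectivelyFibrant F) {x : J}
    (S : ∀ j, (x ⟶ j) → Prop) (hS : ∀ ⦃j k : J⦄ (φ : x ⟶ j) (ψ : j ⟶ k), S j φ → S k (φ ≫ ψ))
    {A B : C} (i : A ⟶ B) (hi : trivialCofibrations C i) (a : A ⟶ F.obj x)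
    (β : ∀ ⦃j : J⦄ (φ : x ⟶ j), S j φ → (B ⟶ F.obj j))
    (hβ : ∀ ⦃j k : J⦄ (φ : x ⟶ j) (ψ : j ⟶ k) (h : S j φ),
      β (φ ≫ ψ) (hS φ ψ h) = β φ h ≫ F.map ψ)
    (hβ' : ∀ ⦃j : J⦄ (φ : x ⟶ j) (h : S j φ), i ≫ β φ h = a ≫ F.map φ) :
    ∃ l : B ⟶ F.obj x, i ≫ l = a ∧ ∀ ⦃j : J⦄ (φ : x ⟶ j) (h : S j φ), l ≫ F.map φ = β φ h := by
  classical
  let χ : ∀ j, (x ⟶ j) → Bool := fun j φ => decide (S j φ)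
  have hχ : ∀ ⦃j k : J⦄ (φ : x ⟶ j) (ψ : j ⟶ k), χ j φ ≤ χ k (φ ≫ ψ) := fun j k φ ψ => by
    simpa [χ, Bool.le_iff_imp] using hS φ ψ
  let G := corepresentableUnion χ hχ i
  let H := corepresentableUnion (J := J) (x := x) (fun _ _ => true) (fun _ _ _ _ => le_rfl) i
  let ιH : ∀ {j : J} (φ : x ⟶ j), B ⟶ H.obj j := fun φ =>
    corepresentableUnion.ι (fun _ _ => true) (fun _ _ _ _ => le_rfl) i φ
  have hιH : ∀ {j k : J} (φ : x ⟶ j) (ψ : j ⟶ k), ιH φ ≫ H.map ψ = ιH (φ ≫ ψ) := fun φ ψ =>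
    (corepresentableUnion.ι_map _ _ i φ ψ).trans (Category.id_comp _)
  let ι : G ⟶ H := corepresentableUnion.desc χ hχ i
    (fun φ => endpointMap i _ true (Bool.le_true _) ≫ ιH φ) (fun φ ψ => by
      rw [reassoc_of% endpointMap_comp, Category.assoc]
      exact congrArg (endpointMap i _ _ _ ≫ ·) (hιH φ ψ).symm)
  have hι : ∀ j, trivialCofibrations C (ι.app j) := fun j => by
    let m : ∀ φ : x ⟶ j, endpoint i (χ j φ) ⟶ endpoint i true :=
      fun φ => endpointMap i (χ j φ) true (Bool.le_true _)
    have : ι.app j = Limits.Sigma.map m :=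
      Sigma.hom_ext _ _ fun φ =>
        (corepresentableUnion.ι_desc_app χ hχ i _ _ φ).trans (Sigma.ι_map m φ).symm
    rw [this]
    exact MorphismProperty.colimMap (W := trivialCofibrations C) _
      (fun ⟨φ⟩ => trivialCofibrations_endpointMap i hi _ _ _)
  -- The Boolean is a free variable rather than χ j φ, so that case analysis on it is possible
  -- although the type of the morphism depends on it.
  let e : ∀ {j : J} (φ : x ⟶ j) (p : Bool), (p = true → S j φ) → (endpoint i p ⟶ F.obj j) :=
    fun {j} φ p => match p with
      | false => fun _ => a ≫ F.map φ
      | true => fun h => β φ (h rfl)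
  have he : ∀ {j k : J} (φ : x ⟶ j) (ψ : j ⟶ k) (p q : Bool) (hp : p = true → S j φ)
      (hq : q = true → S k (φ ≫ ψ)) (hpq : p ≤ q),
      endpointMap i p q hpq ≫ e (φ ≫ ψ) q hq = e φ p hp ≫ F.map ψ := by
    intro j k φ ψ p q hp hq hpq
    cases p <;> cases q
    · exact (Category.id_comp _).trans ((congrArg (a ≫ ·) (F.map_comp φ ψ)).trans
        (Category.assoc _ _ _).symm)
    · exact (hβ' (φ ≫ ψ) (hq rfl)).trans ((congrArg (a ≫ ·) (F.map_comp φ ψ)).trans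
        (Category.assoc _ _ _).symm)
    · exact absurd hpq (by decide)
    · exact (Category.id_comp _).trans (hβ φ ψ (hp rfl))
  let α : G ⟶ F := corepresentableUnion.desc χ hχ i (fun φ => e φ (χ _ φ) (by simp [χ]))
    (fun φ ψ => he φ ψ _ _ _ _ _)
  obtain ⟨L, hL⟩ := (isInjectivelyFibrant_iff F).1 hF ι hι α
  let l : B ⟶ F.obj x := ιH (𝟙 x) ≫ L.app x
  have hl : ∀ {j : J} (φ : x ⟶ j), l ≫ F.map φ = ιH φ ≫ L.app j := by
    intro j φ
    dsimp only [l]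
    rw [Category.assoc, ← L.naturality, reassoc_of% hιH, Category.id_comp]
  have hl' : ∀ {j : J} (φ : x ⟶ j), endpointMap i (χ j φ) true (Bool.le_true _) ≫ l ≫ F.map φ =
      e φ (χ j φ) (by simp [χ]) := by
    intro j φ
    have h₁ : corepresentableUnion.ι χ hχ i φ ≫ α.app j = e φ (χ j φ) (by simp [χ]) :=
      corepresentableUnion.ι_desc_app χ hχ i _ _ φ
    have h₂ : corepresentableUnion.ι χ hχ i φ ≫ ι.app j =
        endpointMap i (χ j φ) true (Bool.le_true _) ≫ ιH φ :=
      corepresentableUnion.ι_desc_app χ hχ i _ _ φ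
    have h₃ := corepresentableUnion.ι χ hχ i φ ≫= NatTrans.congr_app hL j
    rw [NatTrans.comp_app, h₁, ← Category.assoc, h₂] at h₃
    exact ((congrArg (endpointMap i _ _ _ ≫ ·) (hl φ)).trans (Category.assoc _ _ _).symm).trans h₃
  have key : ∀ {j : J} (φ : x ⟶ j) (p : Bool) (hp : p = true → S j φ),
      endpointMap i p true (Bool.le_true _) ≫ l ≫ F.map φ = e φ p hp →
        i ≫ l ≫ F.map φ = a ≫ F.map φ ∧ (p = true → ∀ h : S j φ, l ≫ F.map φ = β φ h) := by
    intro j φ p hp h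
    cases p
    · exact ⟨h, by simp⟩
    · have h' : l ≫ F.map φ = β φ (hp rfl) := (Category.id_comp _).symm.trans h
      exact ⟨by rw [h', hβ'], fun _ _ => h'⟩
  refine ⟨l, by simpa using (key (𝟙 x) _ _ (hl' (𝟙 x))).1, fun j φ h => ?_⟩
  exact (key φ _ _ (hl' φ)).2 (by simpa [χ] using h) h

/-- The case of the empty subfunctor. -/
lemma IsInjectivelyFibrant.isFibrant {F : J ⥤ C} (hF : IsInjectivelyFibrant F) (x : J) :
    IsFibrant (F.obj x) := by
  refine fibration_of_forall_exists_lift _ fun A B i hi a b _ => ?_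
  obtain ⟨l, hl, -⟩ := hF.exists_extension (x := x) (fun _ _ => False) (fun _ _ _ _ h => h) i hi a
    (fun _ _ h => h.elim) (fun _ _ _ _ h => h.elim) (fun _ _ h => h.elim)
  exact ⟨l, hl, Subsingleton.elim _ _⟩

/-- An injectively fibrant diagram sends epimorphisms to fibrations. -/
lemma IsInjectivelyFibrant.fibration_map {F : J ⥤ C} (hF : IsInjectivelyFibrant F) {x y : J}
    (f : x ⟶ y) [Epi f] : Fibration (F.map f) := by
  refine fibration_of_forall_exists_lift _ fun A B i hi a b w => ?_
  have hu : ∀ ⦃j⦄ (φ : x ⟶ j) (h : ∃ χ : y ⟶ j, f ≫ χ = φ) (χ : y ⟶ j), f ≫ χ = φ →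
      h.choose = χ := fun j φ h χ hχ => by
    rw [← cancel_epi f, h.choose_spec, hχ]
  -- The subfunctor is the image of Hom(y, -) under precomposition with f. By `hu` the factorization
  -- through f is unique, so b induces a natural family on this image.
  obtain ⟨l, hl, hl'⟩ := hF.exists_extension (x := x) (fun j φ => ∃ χ : y ⟶ j, f ≫ χ = φ)
    (fun j k φ ψ ⟨χ, hχ⟩ => ⟨χ ≫ ψ, by rw [reassoc_of% hχ]⟩) i hi a
    (fun j φ h => b ≫ F.map h.choose)
    (fun j k φ ψ h => by
      rw [hu _ _ (h.choose ≫ ψ) (by rw [reassoc_of% h.choose_spec]), F.map_comp, Category.assoc])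
    (fun j φ h => by
      rw [← reassoc_of% w, ← F.map_comp, h.choose_spec])
  exact ⟨l, hl, by simpa [hu f _ (𝟙 y) (by simp)] using hl' f ⟨𝟙 y, by simp⟩⟩

end

/-! ### Homotopy pullbacks -/

section

variable {C : Type u} [Category.{v} C] [ModelCategory C]

lemma trivialCofibration_exists_lift {A B X Y : C} {i : A ⟶ B} (hi : trivialCofibrations C i)
    (p : X ⟶ Y) [Fibration p] (a : A ⟶ X) (b : B ⟶ Y) (w : a ≫ p = i ≫ b) :
    ∃ l : B ⟶ X, i ≫ l = a ∧ l ≫ p = b := by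
  obtain ⟨_, _⟩ := (mem_trivialCofibrations_iff i).1 hi
  have sq : CommSq a i p b := ⟨w⟩
  exact ⟨sq.lift, sq.fac_left, sq.fac_right⟩

lemma trivialCofibration_exists_extension {A B : C} {i : A ⟶ B} (hi : trivialCofibrations C i)
    (X : C) [IsFibrant X] (a : A ⟶ X) : ∃ l : B ⟶ X, i ≫ l = a := by
  obtain ⟨l, hl, -⟩ := trivialCofibration_exists_lift hi (terminal.from X) a (terminal.from B)
    (Subsingleton.elim _ _)
  exact ⟨l, hl⟩

lemma isInjectivelyFibrant_cospan {A B D : C} (f : A ⟶ B) (g : D ⟶ B) [Fibration f] [Fibration g]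
    [IsFibrant B] : IsInjectivelyFibrant (cospan f g) := by
  rw [isInjectivelyFibrant_iff]
  intro G H i hi a
  obtain ⟨b, hb⟩ := trivialCofibration_exists_extension (hi .one) B (a.app .one)
  obtain ⟨l, hl, hl'⟩ := trivialCofibration_exists_lift (hi .left) f (a.app .left)
    (H.map WalkingCospan.Hom.inl ≫ b) (by
      rw [← i.naturality_assoc, hb]; exact (a.naturality WalkingCospan.Hom.inl).symm)
  obtain ⟨r, hr, hr'⟩ := trivialCofibration_exists_lift (hi .right) g (a.app .right)
    (H.map WalkingCospan.Hom.inr ≫ b) (by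
      rw [← i.naturality_assoc, hb]; exact (a.naturality WalkingCospan.Hom.inr).symm)
  refine ⟨cospanHomMk b l r hl'.symm hr'.symm, ?_⟩
  ext (_ | _ | _)
  exacts [hb, hl, hr]

/-- Replacing the morphism `g` in a cospan by a fibration. -/
lemma exists_fibrantReplacement_cospan {A B D : C} (f : A ⟶ B) (g : D ⟶ B) [Fibration f]
    [IsFibrant B] : ∃ R : FibrantReplacement (cospan f g), IsIso (R.ι.app .left) := by
  let F := MorphismProperty.factorizationData (trivialCofibrations C) (fibrations C) g
  refine ⟨{ diagram := cospan f F.p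
            ι := cospanHomMk (𝟙 B) (𝟙 A) F.i (by simp) (by simp)
            weakEquivalence := ?_
            fibrant := isInjectivelyFibrant_cospan f F.p },
    (inferInstance : IsIso (𝟙 A))⟩
  rintro (_ | _ | _)
  · exact (inferInstance : WeakEquivalence (𝟙 B))
  · exact (inferInstance : WeakEquivalence (𝟙 A))
  · exact (inferInstance : WeakEquivalence F.i)

/-- The homotopy limit of a cospan of fibrant objects, one leg of which is a fibration, is its
strict pullback. -/
lemma weakEquivalence_lift_of_fibrantReplacement {A B D : C} {f : A ⟶ B} {g : D ⟶ B} [IsFibrant A]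
    [IsFibrant B] [IsFibrant D] [Fibration f] (R : FibrantReplacement (cospan f g))
    {l : Cone R.diagram} (hl : IsLimit l) {P : C} {a : P ⟶ A} {b : P ⟶ D} (h : IsPullback a b f g)
    (φ : P ⟶ l.pt) (h₁ : φ ≫ l.π.app .left = a ≫ R.ι.app .left)
    (h₂ : φ ≫ l.π.app .right = b ≫ R.ι.app .right) : WeakEquivalence φ := by
  have hR := IsPullback.of_isLimit_cone hl
  have : Epi WalkingCospan.Hom.inl := ⟨fun _ _ _ => Subsingleton.elim _ _⟩
  have := R.fibrant.fibration_map WalkingCospan.Hom.inl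
  have := R.fibrant.isFibrant .right
  have := R.fibrant.isFibrant .one
  let x : A ⟶ R.diagram.obj .left := R.ι.app .left
  let y : D ⟶ R.diagram.obj .right := R.ι.app .right
  let z : B ⟶ R.diagram.obj .one := R.ι.app .one
  have : WeakEquivalence x := R.weakEquivalence .left
  have : WeakEquivalence y := R.weakEquivalence .right
  have : WeakEquivalence z := R.weakEquivalence .one
  -- The cogluing lemma wants the fibration as second leg, while here it is f, hence the flips.
  exact weakEquivalence_of_isPullback_of_isPullback h.flip hR.flip y x z
    (R.ι.naturality WalkingCospan.Hom.inr).symm (R.ι.naturality WalkingCospan.Hom.inl).symm φ h₂ h₁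

lemma isHomotopyLimit_iff_isHoPullback {A B D : C} {f : A ⟶ B} {g : D ⟶ B} [IsFibrant A]
    [IsFibrant B] [IsFibrant D] [Fibration f] (c : PullbackCone f g) :
    IsHomotopyLimit c ↔ IsHoPullback c.fst c.snd f g := by
  obtain ⟨S, a, b, hS⟩ := exists_isPullback f g
  let ψ : c.pt ⟶ S := hS.lift c.fst c.snd c.condition
  -- The definition asks for some replacement; the comparison from the strict pullback S is a weak
  -- equivalence for every one of them, so the choice is irrelevant.
  have key : ∀ (R : FibrantReplacement (cospan f g)) (l : Cone R.diagram) (hl : IsLimit l),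
      WeakEquivalence (hl.lift ((Cone.postcompose R.ι).obj c)) ↔ WeakEquivalence ψ := by
    intro R l hl
    let φ : S ⟶ l.pt := hl.lift ((Cone.postcompose R.ι).obj (PullbackCone.mk a b hS.w))
    have h₁ : φ ≫ l.π.app .left = a ≫ R.ι.app .left := hl.fac _ _
    have h₂ : φ ≫ l.π.app .right = b ≫ R.ι.app .right := hl.fac _ _
    have : WeakEquivalence φ := weakEquivalence_lift_of_fibrantReplacement R hl hS φ h₁ h₂
    have h : hl.lift ((Cone.postcompose R.ι).obj c) = ψ ≫ φ := by
      refine (IsPullback.of_isLimit_cone hl).hom_ext ?_ ?_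
      · exact (hl.fac _ _).trans (((hS.lift_fst _ _ c.condition).symm =≫ R.ι.app .left).trans
          ((Category.assoc _ _ _).trans ((ψ ≫= h₁.symm).trans
            (Category.assoc _ _ _).symm)))
      · exact (hl.fac _ _).trans (((hS.lift_snd _ _ c.condition).symm =≫ R.ι.app .right).trans
          ((Category.assoc _ _ _).trans ((ψ ≫= h₂.symm).trans
            (Category.assoc _ _ _).symm)))
    rw [h, weakEquivalence_postcomp_iff]
  constructor
  · rintro ⟨R, l, hl, h⟩
    exact ⟨S, a, b, ψ, hS, hS.lift_fst _ _ _, hS.lift_snd _ _ _, (key R l hl).1 h⟩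
  · intro h
    obtain ⟨R, -⟩ := exists_fibrantReplacement_cospan f g
    exact ⟨R, _, limit.isLimit _, (key R _ _).2
      (h.weakEquivalence hS ψ (hS.lift_fst _ _ _) (hS.lift_snd _ _ _))⟩

lemma projectionThenIsWeakEquivalence_iff {P A B D E : C} {f : A ⟶ B} {g : D ⟶ B} {h : A ⟶ E}
    [IsFibrant A] [IsFibrant B] [IsFibrant D] [Fibration f] {a : P ⟶ A} {b : P ⟶ D}
    (hP : IsPullback a b f g) :
    ProjectionThenIsWeakEquivalence f g h ↔ WeakEquivalence (a ≫ h) := by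
  have key : ∀ (R : FibrantReplacement (cospan f g)) (l : Cone R.diagram) (_ : IsLimit l) (E' : C)
      (σ : E ⟶ E') (h' : R.diagram.obj WalkingCospan.left ⟶ E') (_ : WeakEquivalence σ)
      (_ : R.ι.app WalkingCospan.left ≫ h' = h ≫ σ),
      WeakEquivalence (l.π.app WalkingCospan.left ≫ h') ↔ WeakEquivalence (a ≫ h) := by
    intro R l hl E' σ h' _ hσ
    let φ : P ⟶ l.pt := hl.lift ((Cone.postcompose R.ι).obj (PullbackCone.mk a b hP.w))
    have h₁ : φ ≫ l.π.app .left = a ≫ R.ι.app .left := hl.fac _ _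
    have h₂ : φ ≫ l.π.app .right = b ≫ R.ι.app .right := hl.fac _ _
    have : WeakEquivalence φ := weakEquivalence_lift_of_fibrantReplacement R hl hP φ h₁ h₂
    have h₃ : φ ≫ l.π.app WalkingCospan.left ≫ h' = (a ≫ h) ≫ σ := by
      rw [← Category.assoc, h₁]
      exact (Category.assoc _ _ _).trans ((a ≫= hσ).trans (Category.assoc _ _ _).symm)
    rw [← weakEquivalence_precomp_iff φ, h₃, weakEquivalence_postcomp_iff]
  constructor
  · rintro ⟨R, l, hl, E', σ, h', hσ, hσ', H⟩
    exact (key R l hl E' σ h' hσ hσ').1 H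
  · intro H
    obtain ⟨R, _⟩ := exists_fibrantReplacement_cospan f g
    -- This replacement alters only D, so h extends to the replaced A by inverting an isomorphism,
    -- and E may stay unreplaced.
    have w : R.ι.app .left ≫ inv (R.ι.app .left) ≫ h = h ≫ 𝟙 E := by
      rw [Category.comp_id]
      exact IsIso.hom_inv_id_assoc _ _
    exact ⟨R, _, limit.isLimit _, E, 𝟙 E, _, inferInstance, w,
      (key R _ (limit.isLimit _) E (𝟙 E) _ inferInstance w).2 H⟩

end

/-! ### Limits of spines -/

section

variable {C : Type u} [Category.{v} C]

/-- The maps `p a : L ⟶ E a` exhibit `L` as the iterated fibre product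
`E 0 ×_{V 0} E 1 ×_{V 1} ⋯ ×_{V (m - 1)} E m`. -/
structure IsSpineLimit {m : ℕ} {E : Fin (m + 1) → C} {V : Fin m → C}
    (t : ∀ i : Fin m, E i.castSucc ⟶ V i) (s : ∀ i : Fin m, E i.succ ⟶ V i) {L : C}
    (p : ∀ a, L ⟶ E a) : Prop where
  w (i : Fin m) : p i.castSucc ≫ t i = p i.succ ≫ s i
  exists_lift {T : C} (q : ∀ a, T ⟶ E a) (hq : ∀ i : Fin m, q i.castSucc ≫ t i = q i.succ ≫ s i) :
    ∃ r : T ⟶ L, ∀ a, r ≫ p a = q a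
  hom_ext {T : C} {r r' : T ⟶ L} (h : ∀ a, r ≫ p a = r' ≫ p a) : r = r'

namespace IsSpineLimit

lemma of_zero {E : Fin 1 → C} {V : Fin 0 → C} (t : ∀ i : Fin 0, E i.castSucc ⟶ V i)
    (s : ∀ i : Fin 0, E i.succ ⟶ V i) :
    IsSpineLimit t s (L := E 0) (Fin.cases (𝟙 _) (fun i => i.elim0)) where
  w i := i.elim0
  exists_lift q _ := ⟨q 0, Fin.cases (Category.comp_id _) (fun i => i.elim0)⟩
  hom_ext h := by simpa using h 0

lemma isIso_zero {E : Fin 1 → C} {V : Fin 0 → C} {t : ∀ i : Fin 0, E i.castSucc ⟶ V i}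
    {s : ∀ i : Fin 0, E i.succ ⟶ V i} {L : C} {p : ∀ a, L ⟶ E a} (h : IsSpineLimit t s p) :
    IsIso (p 0) := by
  obtain ⟨r, hr⟩ := h.exists_lift (Fin.cases (𝟙 (E 0)) (fun i => i.elim0)) (fun i => i.elim0)
  have h0 : r ≫ p 0 = 𝟙 _ := hr 0
  exact ⟨r, h.hom_ext (Fin.cases (by simp [h0]) (fun i => i.elim0)), h0⟩

variable {m : ℕ} {E : Fin (m + 2) → C} {V : Fin (m + 1) → C}
    {t : ∀ i : Fin (m + 1), E i.castSucc ⟶ V i} {s : ∀ i : Fin (m + 1), E i.succ ⟶ V i}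
    {L : C} {p : ∀ a : Fin (m + 1), L ⟶ E a.castSucc}

lemma of_isPullback (h : IsSpineLimit (E := fun a => E a.castSucc) (V := fun i => V i.castSucc)
      (fun i => t i.castSucc) (fun i => s i.castSucc) p) {L' : C} {a : L' ⟶ L}
    {b : L' ⟶ E (Fin.last (m + 1))}
    (hL : IsPullback a b (p (Fin.last m) ≫ t (Fin.last m)) (s (Fin.last m))) {p' : ∀ a, L' ⟶ E a}
    (hp : ∀ i, p' i.castSucc = a ≫ p i) (hp' : p' (Fin.last (m + 1)) = b) :
    IsSpineLimit t s p' where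
  w i := by
    induction i using Fin.lastCases with
    | last => simpa [hp, ← hp'] using hL.w
    | cast i =>
      have := a ≫= h.w i
      rw [← Category.assoc, ← Category.assoc, ← hp, ← hp] at this
      exact this
  exists_lift q hq := by
    obtain ⟨r, hr⟩ := h.exists_lift (fun a => q a.castSucc) (fun i => hq i.castSucc)
    refine ⟨hL.lift r (q (Fin.last _)) ?_, fun a => ?_⟩
    · rw [← Category.assoc, hr]
      exact hq (Fin.last m)
    · induction a using Fin.lastCases with
      | last => rw [hp', hL.lift_snd]
      | cast i => rw [hp, hL.lift_fst_assoc, hr]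
  hom_ext {T r r'} hr := by
    refine hL.hom_ext (h.hom_ext fun i => ?_) ?_
    · simpa [hp] using hr i.castSucc
    · simpa [hp'] using hr (Fin.last _)

/-- Splitting off the last edge presents a spine limit as one pullback over a shorter spine; this is
the inductive step for fibrancy and homotopy invariance. -/
lemma exists_isPullback (h : IsSpineLimit (E := fun a => E a.castSucc) (V := fun i => V i.castSucc)
      (fun i => t i.castSucc) (fun i => s i.castSucc) p) {L' : C} {p' : ∀ a, L' ⟶ E a}
    (h' : IsSpineLimit t s p') : ∃ a : L' ⟶ L, (∀ i, a ≫ p i = p' i.castSucc) ∧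
      IsPullback a (p' (Fin.last _)) (p (Fin.last m) ≫ t (Fin.last m)) (s (Fin.last m)) := by
  obtain ⟨a, ha⟩ := h.exists_lift (fun i => p' i.castSucc) (fun i => h'.w i.castSucc)
  have w : a ≫ p (Fin.last m) ≫ t (Fin.last m) = p' (Fin.last _) ≫ s (Fin.last m) := by
    rw [← Category.assoc, ha]
    exact h'.w (Fin.last m)
  have key : ∀ {T : C} (x : T ⟶ L) (y : T ⟶ E (Fin.last (m + 1)))
      (_ : x ≫ p (Fin.last m) ≫ t (Fin.last m) = y ≫ s (Fin.last m)),
      ∃ r : T ⟶ L', r ≫ a = x ∧ r ≫ p' (Fin.last _) = y := by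
    intro T x y hxy
    let q : ∀ i, T ⟶ E i := fun i =>
      Fin.lastCases (motive := fun i => T ⟶ E i) y (fun i => x ≫ p i) i
    have hq : ∀ i : Fin (m + 1), q i.castSucc = x ≫ p i := fun i => Fin.lastCases_castSucc _
    have hq' : q (Fin.last _) = y := Fin.lastCases_last
    obtain ⟨r, hr⟩ := h'.exists_lift q (fun i => by
      induction i using Fin.lastCases with
      | last =>
        rw [hq, Category.assoc]
        exact hxy.trans (hq' =≫ s (Fin.last m)).symm
      | cast i =>
        rw [hq, Category.assoc]
        refine (x ≫= h.w i).trans ((Category.assoc _ _ _).symm.trans ?_)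
        exact (hq i.succ =≫ s i.castSucc).symm)
    refine ⟨r, h.hom_ext fun i => ?_, (hr _).trans hq'⟩
    rw [Category.assoc, ha, hr, hq]
  refine ⟨a, ha, IsPullback.of_isLimit' ⟨w⟩ (PullbackCone.IsLimit.mk _
    (fun c => (key c.fst c.snd c.condition).choose)
    (fun c => (key c.fst c.snd c.condition).choose_spec.1)
    (fun c => (key c.fst c.snd c.condition).choose_spec.2) (fun c r h₁ h₂ => ?_))⟩
  have hc := (key c.fst c.snd c.condition).choose_spec
  refine h'.hom_ext fun i => ?_
  induction i using Fin.lastCases with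
  | last => rw [h₂, hc.2]
  | cast i => rw [← ha, ← Category.assoc, h₁, ← Category.assoc, hc.1]

end IsSpineLimit

lemma exists_isSpineLimit [HasPullbacks C] {m : ℕ} {E : Fin (m + 1) → C} {V : Fin m → C}
    (t : ∀ i : Fin m, E i.castSucc ⟶ V i) (s : ∀ i : Fin m, E i.succ ⟶ V i) :
    ∃ (L : C) (p : ∀ a, L ⟶ E a), IsSpineLimit t s p := by
  induction m with
  | zero => exact ⟨_, _, IsSpineLimit.of_zero t s⟩
  | succ m ih =>
    obtain ⟨L, p, h⟩ := ih (E := fun a => E a.castSucc) (V := fun i => V i.castSucc)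
      (fun i => t i.castSucc) (fun i => s i.castSucc)
    exact ⟨_, fun i => Fin.lastCases (motive := fun i => _ ⟶ E i) _ (fun i => _ ≫ p i) i,
      h.of_isPullback (IsPullback.of_hasPullback _ _) (fun i => Fin.lastCases_castSucc _)
        Fin.lastCases_last⟩

variable [ModelCategory C]

lemma IsSpineLimit.isFibrant {m : ℕ} {E : Fin (m + 1) → C} {V : Fin m → C}
    {t : ∀ i : Fin m, E i.castSucc ⟶ V i} {s : ∀ i : Fin m, E i.succ ⟶ V i} {L : C}
    {p : ∀ a, L ⟶ E a} (h : IsSpineLimit t s p) (hE : ∀ a, IsFibrant (E a))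
    (hs : ∀ i, Fibration (s i)) : IsFibrant L := by
  induction m generalizing L with
  | zero =>
    have := h.isIso_zero
    have := hE 0
    exact isFibrant_of_fibration (p 0)
  | succ m ih =>
    obtain ⟨K, k, hK⟩ := exists_isSpineLimit (E := fun a => E a.castSucc)
      (V := fun i => V i.castSucc) (fun i => t i.castSucc) (fun i => s i.castSucc)
    have := ih hK (fun a => hE a.castSucc) (fun i => hs i.castSucc)
    obtain ⟨a, -, ha⟩ := hK.exists_isPullback h
    have := hs (Fin.last m)
    have := fibration_fst_of_isPullback ha
    exact isFibrant_of_fibration a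

/-- Limits of spines of fibrant objects are invariant under levelwise weak equivalences. -/
lemma IsSpineLimit.weakEquivalence {m : ℕ} {E E' : Fin (m + 1) → C} {V V' : Fin m → C}
    {t : ∀ i : Fin m, E i.castSucc ⟶ V i} {s : ∀ i : Fin m, E i.succ ⟶ V i}
    {t' : ∀ i : Fin m, E' i.castSucc ⟶ V' i} {s' : ∀ i : Fin m, E' i.succ ⟶ V' i} {L L' : C}
    {p : ∀ a, L ⟶ E a} {p' : ∀ a, L' ⟶ E' a} (h : IsSpineLimit t s p) (h' : IsSpineLimit t' s' p')
    (hE : ∀ a, IsFibrant (E a)) (hE' : ∀ a, IsFibrant (E' a)) (hV : ∀ i, IsFibrant (V i))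
    (hV' : ∀ i, IsFibrant (V' i)) (hs : ∀ i, Fibration (s i)) (hs' : ∀ i, Fibration (s' i))
    (e : ∀ a, E a ⟶ E' a) (he : ∀ a, WeakEquivalence (e a)) (x : ∀ i, V i ⟶ V' i)
    (hx : ∀ i, WeakEquivalence (x i)) (ht : ∀ i, e _ ≫ t' i = t i ≫ x i)
    (hs'' : ∀ i, e _ ≫ s' i = s i ≫ x i) (φ : L ⟶ L') (hφ : ∀ a, φ ≫ p' a = p a ≫ e a) :
    WeakEquivalence φ := by
  induction m generalizing L L' with
  | zero =>
    have := h.isIso_zero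
    have := h'.isIso_zero
    have := he 0
    have : WeakEquivalence (φ ≫ p' 0) := by rw [hφ]; infer_instance
    exact weakEquivalence_of_postcomp φ (p' 0)
  | succ m ih =>
    obtain ⟨K, k, hK⟩ := exists_isSpineLimit (E := fun a => E a.castSucc)
      (V := fun i => V i.castSucc) (fun i => t i.castSucc) (fun i => s i.castSucc)
    obtain ⟨K', k', hK'⟩ := exists_isSpineLimit (E := fun a => E' a.castSucc)
      (V := fun i => V' i.castSucc) (fun i => t' i.castSucc) (fun i => s' i.castSucc)
    obtain ⟨a, ha, hL⟩ := hK.exists_isPullback h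
    obtain ⟨a', ha', hL'⟩ := hK'.exists_isPullback h'
    obtain ⟨ψ, hψ⟩ := hK'.exists_lift (fun a => k a ≫ e a.castSucc) (fun i => by
      rw [Category.assoc, ht i.castSucc, ← Category.assoc, hK.w, Category.assoc]
      simp only [← hs'', Category.assoc]
      rfl)
    have := ih hK hK' (fun a => hE a.castSucc) (fun a => hE' a.castSucc) (fun i => hV i.castSucc)
      (fun i => hV' i.castSucc) (fun i => hs i.castSucc) (fun i => hs' i.castSucc)
      (fun a => e a.castSucc) (fun a => he a.castSucc) (fun i => x i.castSucc)
      (fun i => hx i.castSucc) (fun i => ht i.castSucc) (fun i => hs'' i.castSucc) ψ hψ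
    have := hK.isFibrant (fun a => hE a.castSucc) (fun i => hs i.castSucc)
    have := hK'.isFibrant (fun a => hE' a.castSucc) (fun i => hs' i.castSucc)
    have := hs (Fin.last m)
    have := hs' (Fin.last m)
    have := hV (Fin.last m)
    have := hV' (Fin.last m)
    have := he (Fin.last _)
    have := hx (Fin.last _)
    refine weakEquivalence_of_isPullback_of_isPullback hL hL' ψ (e (Fin.last _)) (x (Fin.last m))
      ?_ (hs'' (Fin.last m)) φ (hK'.hom_ext fun i => ?_) (hφ _)
    · rw [← Category.assoc, hψ, Category.assoc, ht, Category.assoc]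
    · rw [Category.assoc, ha', hφ, Category.assoc, hψ, ← Category.assoc, ha]

end

/-! ### Homotopy limits of spines -/

section

variable {C : Type u} [Category.{v} C]

/-- A natural transformation between diagrams of multicospan shape. -/
def multicospanHomMk {J : MulticospanShape.{w, v₁}} {F G : WalkingMulticospan J ⥤ C}
    (l : ∀ a, F.obj (.left a) ⟶ G.obj (.left a)) (r : ∀ b, F.obj (.right b) ⟶ G.obj (.right b))
    (hfst : ∀ b, F.map (WalkingMulticospan.Hom.fst b) ≫ r b =
      l _ ≫ G.map (WalkingMulticospan.Hom.fst b))
    (hsnd : ∀ b, F.map (WalkingMulticospan.Hom.snd b) ≫ r b =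
      l _ ≫ G.map (WalkingMulticospan.Hom.snd b)) : F ⟶ G where
  app := fun
    | .left a => l a
    | .right b => r b
  naturality := by
    rintro _ _ (_ | b | b)
    · simp
    · exact hfst b
    · exact hsnd b

instance {J : MulticospanShape.{w, v₁}} (b : J.R) (y : WalkingMulticospan J) :
    Subsingleton (.right b ⟶ y) :=
  ⟨by rintro ⟨⟩ ⟨⟩; rfl⟩

instance {J : MulticospanShape.{w, v₁}} (x y : WalkingMulticospan J) : Finite (x ⟶ y) := by
  rcases x with l | r <;> rcases y with l' | r'
  · have : Subsingleton ((.left l : WalkingMulticospan J) ⟶ .left l') :=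
      ⟨by rintro ⟨⟩ ⟨⟩; rfl⟩
    infer_instance
  · let f : PLift (J.fst r' = l) ⊕ PLift (J.snd r' = l) →
        ((.left l : WalkingMulticospan J) ⟶ .right r') :=
      Sum.elim (fun ⟨h⟩ => by subst h; exact .fst r') (fun ⟨h⟩ => by subst h; exact .snd r')
    refine Finite.of_surjective f ?_
    rintro (_ | _)
    · exact ⟨Sum.inl ⟨rfl⟩, rfl⟩
    · exact ⟨Sum.inr ⟨rfl⟩, rfl⟩
  · infer_instance
  · infer_instance

lemma _root_.Fin.exists_extend_castSucc {m : ℕ} {α : Fin (m + 1) → Sort*} {P : ∀ a, α a → Prop}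
    (x : ∃ x, P (Fin.last m) x) (y : ∀ b : Fin m, α b.castSucc) (hy : ∀ b, P _ (y b)) :
    ∃ z : ∀ a, α a, (∀ a, P a (z a)) ∧ ∀ b : Fin m, z b.castSucc = y b := by
  obtain ⟨x, hx⟩ := x
  refine ⟨fun a => Fin.lastCases x y a, fun a => ?_, fun b => Fin.lastCases_castSucc _⟩
  induction a using Fin.lastCases with
  | last => beta_reduce; rwa [Fin.lastCases_last]
  | cast b => beta_reduce; rw [Fin.lastCases_castSucc]; exact hy b

lemma _root_.Fin.exists_extend_succ {m : ℕ} {α : Fin (m + 1) → Sort*} {P : ∀ a, α a → Prop}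
    (x : ∃ x, P 0 x) (y : ∀ b : Fin m, α b.succ) (hy : ∀ b, P _ (y b)) :
    ∃ z : ∀ a, α a, (∀ a, P a (z a)) ∧ ∀ b : Fin m, z b.succ = y b := by
  obtain ⟨x, hx⟩ := x
  exact ⟨fun a => Fin.cases x y a, fun a => Fin.cases hx hy a, fun b => rfl⟩

variable {m : ℕ}

lemma isSpineLimit_of_isLimit {F : WalkingMulticospan (spineShape m) ⥤ C} {l : Cone F}
    (hl : IsLimit l) :
    IsSpineLimit (E := fun a => F.obj (.left a)) (V := fun b => F.obj (.right b))
      (fun b : Fin m => F.map (WalkingMulticospan.Hom.fst (J := spineShape m) b))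
      (fun b : Fin m => F.map (WalkingMulticospan.Hom.snd (J := spineShape m) b))
      (fun a => l.π.app (.left a)) where
  w i := (l.w (WalkingMulticospan.Hom.fst (J := spineShape m) i)).trans
    (l.w (WalkingMulticospan.Hom.snd (J := spineShape m) i)).symm
  exists_lift {T} q hq := by
    let c : Cone F :=
      { pt := T
        π := multicospanHomMk (F := (Functor.const _).obj T) q
          (fun b => q b.castSucc ≫ F.map (WalkingMulticospan.Hom.fst (J := spineShape m) b))
          (fun b => Category.id_comp _) (fun b => (Category.id_comp _).trans (hq b)) }
    exact ⟨hl.lift c, fun a => hl.fac c (.left a)⟩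
  hom_ext {T r r'} h := by
    refine hl.hom_ext ?_
    rintro (a | b)
    · exact h a
    · rw [← l.w (WalkingMulticospan.Hom.fst (J := spineShape m) b)]
      exact (Category.assoc _ _ _).symm.trans ((h b.castSucc =≫ _).trans (Category.assoc _ _ _))

lemma IsSpineLimit.exists_isLimit {F : WalkingMulticospan (spineShape m) ⥤ C} {L : C}
    {p : ∀ a : Fin (m + 1), L ⟶ F.obj (.left a)}
    (h : IsSpineLimit (E := fun a => F.obj (.left a)) (V := fun b => F.obj (.right b))
      (fun b : Fin m => F.map (WalkingMulticospan.Hom.fst (J := spineShape m) b))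
      (fun b : Fin m => F.map (WalkingMulticospan.Hom.snd (J := spineShape m) b)) p) :
    ∃ l : Cone F, Nonempty (IsLimit l) := by
  let l : Cone F :=
    { pt := L
      π := multicospanHomMk (F := (Functor.const _).obj L) p
        (fun b => p b.castSucc ≫ F.map (WalkingMulticospan.Hom.fst (J := spineShape m) b))
        (fun b => Category.id_comp _) (fun b => (Category.id_comp _).trans (h.w b)) }
  have key : ∀ c : Cone F, ∃ r : c.pt ⟶ L, ∀ a, r ≫ p a = c.π.app (.left a) := fun c =>
    h.exists_lift (fun a => c.π.app (.left a)) fun b =>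
      (c.w (WalkingMulticospan.Hom.fst (J := spineShape m) b)).trans
        (c.w (WalkingMulticospan.Hom.snd (J := spineShape m) b)).symm
  refine ⟨l, ⟨{ lift := fun c => (key c).choose, fac := ?_, uniq := ?_ }⟩⟩
  · rintro c (a | b)
    · exact (key c).choose_spec a
    · rw [← l.w (WalkingMulticospan.Hom.fst (J := spineShape m) b),
        ← c.w (WalkingMulticospan.Hom.fst (J := spineShape m) b)]
      exact (Category.assoc _ _ _).symm.trans ((key c).choose_spec b.castSucc =≫ _)
  · intro c r hr
    exact h.hom_ext fun a => (hr (.left a)).trans ((key c).choose_spec a).symm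

variable [ModelCategory C]

/-- The diagram `E → V ← E → ⋯ ← E` with `m + 1` copies of `E`. -/
abbrev constSpineIndex {E V : C} (t s : E ⟶ V) (m : ℕ) : MulticospanIndex (spineShape m) C where
  left _ := E
  right _ := V
  fst _ := t
  snd _ := s

/-- An inner edge has both endpoints prescribed by lifts already chosen at the vertices, so the two
legs must form a fibration jointly, onto V ⨯ V. -/
lemma isInjectivelyFibrant_constSpine {E V : C} [IsFibrant V] (p : E ⟶ V ⨯ V) [Fibration p]
    (m : ℕ) : IsInjectivelyFibrant
      (constSpineIndex (p ≫ prod.fst) (p ≫ prod.snd) m).multicospan := by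
  rw [isInjectivelyFibrant_iff]
  intro G H i hi a
  let fst (b : Fin m) : WalkingMulticospan.left (J := spineShape m) b.castSucc ⟶ .right b :=
    WalkingMulticospan.Hom.fst (J := spineShape m) b
  let snd (b : Fin m) : WalkingMulticospan.left (J := spineShape m) b.succ ⟶ .right b :=
    WalkingMulticospan.Hom.snd (J := spineShape m) b
  let α (a' : Fin (m + 1)) : G.obj (.left a') ⟶ E := a.app (.left a')
  have hr : ∀ b : Fin m, ∃ r : H.obj (.right b) ⟶ V, i.app (.right b) ≫ r = a.app (.right b) :=
    fun b => trivialCofibration_exists_extension (hi _) _ _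
  choose r hr using hr
  -- T is the first coordinate of the edges. The last edge meets no vertex there, so fibrancy of V
  -- supplies an arbitrary extension; for the second coordinate S the exceptional edge is the
  -- initial one.
  obtain ⟨T, hT, hT'⟩ := Fin.exists_extend_castSucc
    (α := fun a' : Fin (m + 1) => H.obj (.left a') ⟶ V)
    (P := fun a' f => i.app (.left a') ≫ f = α a' ≫ p ≫ prod.fst)
    (trivialCofibration_exists_extension (hi _) _ _) (fun b => H.map (fst b) ≫ r b) (fun b => by
      rw [← i.naturality_assoc, hr]
      exact a.naturality (fst b))
  obtain ⟨S, hS, hS'⟩ := Fin.exists_extend_succ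
    (α := fun a' : Fin (m + 1) => H.obj (.left a') ⟶ V)
    (P := fun a' f => i.app (.left a') ≫ f = α a' ≫ p ≫ prod.snd)
    (trivialCofibration_exists_extension (hi _) _ _) (fun b => H.map (snd b) ≫ r b) (fun b => by
      rw [← i.naturality_assoc, hr]
      exact a.naturality (snd b))
  have hl : ∀ a' : Fin (m + 1), ∃ l : H.obj (.left a') ⟶ E,
      i.app (.left a') ≫ l = α a' ∧ l ≫ p = prod.lift (T a') (S a') := fun a' =>
    trivialCofibration_exists_lift (hi _) p _ _ (by
      apply Limits.prod.hom_ext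
      · rw [Category.assoc (i.app _), prod.lift_fst, hT, Category.assoc]
      · rw [Category.assoc (i.app _), prod.lift_snd, hS, Category.assoc])
  choose l hl hl' using hl
  refine ⟨multicospanHomMk l r (fun b => ?_) (fun b => ?_), ?_⟩
  · refine (hT' b).symm.trans (Eq.trans ?_ (Category.assoc _ _ _))
    exact ((hl' b.castSucc =≫ prod.fst).trans (prod.lift_fst _ _)).symm
  · refine (hS' b).symm.trans (Eq.trans ?_ (Category.assoc _ _ _))
    exact ((hl' b.succ =≫ prod.snd).trans (prod.lift_snd _ _)).symm
  · ext (a' | b)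
    exacts [hl a', hr b]

lemma nonempty_fibrantReplacement_constSpine {E V : C} (t s : E ⟶ V) [IsFibrant V] (m : ℕ) :
    Nonempty (FibrantReplacement (constSpineIndex t s m).multicospan) := by
  let F := MorphismProperty.factorizationData (trivialCofibrations C) (fibrations C)
    (prod.lift t s)
  refine ⟨{ diagram := (constSpineIndex (F.p ≫ prod.fst) (F.p ≫ prod.snd) m).multicospan
            ι := multicospanHomMk (fun _ => F.i) (fun _ => 𝟙 V) (fun b => ?_) (fun b => ?_)
            weakEquivalence := ?_
            fibrant := isInjectivelyFibrant_constSpine F.p m }⟩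
  · refine (Category.comp_id _).trans (Eq.trans ?_ (Category.assoc _ _ _))
    exact ((F.fac =≫ prod.fst).trans (prod.lift_fst _ _)).symm
  · refine (Category.comp_id _).trans (Eq.trans ?_ (Category.assoc _ _ _))
    exact ((F.fac =≫ prod.snd).trans (prod.lift_snd _ _)).symm
  · rintro (a | b)
    · exact (inferInstance : WeakEquivalence F.i)
    · exact (inferInstance : WeakEquivalence (𝟙 V))

/-- The homotopy limit of a spine of fibrant objects, whose left pointing maps are fibrations, is
its strict limit. -/
lemma isHomotopyLimit_constSpine_iff {E V : C} {t s : E ⟶ V} [IsFibrant E] [IsFibrant V]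
    [Fibration s] (c : Multifork (constSpineIndex t s m)) {L : C} {p : Fin (m + 1) → (L ⟶ E)}
    (h : IsSpineLimit (V := fun _ => V) (fun _ => t) (fun _ => s) p) (ψ : c.pt ⟶ L)
    (hψ : ∀ a, ψ ≫ p a = c.ι a) : IsHomotopyLimit c ↔ WeakEquivalence ψ := by
  have key : ∀ (R : FibrantReplacement (constSpineIndex t s m).multicospan) (l : Cone R.diagram)
      (hl : IsLimit l),
      WeakEquivalence (hl.lift ((Cone.postcompose R.ι).obj c)) ↔ WeakEquivalence ψ := by
    intro R l hl
    have hR := isSpineLimit_of_isLimit hl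
    obtain ⟨φ, hφ⟩ := hR.exists_lift (fun a => p a ≫ R.ι.app (.left a)) (fun b => by
      have h₁ := R.ι.naturality (WalkingMulticospan.Hom.fst (J := spineShape m) b)
      have h₂ := R.ι.naturality (WalkingMulticospan.Hom.snd (J := spineShape m) b)
      refine (Category.assoc _ _ _).trans ((p b.castSucc ≫= h₁.symm).trans ?_)
      refine Eq.trans ?_ ((p b.succ ≫= h₂).trans (Category.assoc _ _ _).symm)
      exact (Category.assoc _ _ _).symm.trans
        ((h.w b =≫ R.ι.app (.right b)).trans (Category.assoc _ _ _)))
    have : WeakEquivalence φ := by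
      refine h.weakEquivalence hR (fun _ => inferInstance) (fun a => R.fibrant.isFibrant _)
        (fun _ => inferInstance) (fun a => R.fibrant.isFibrant _) (fun _ => inferInstance)
        (fun b => ?_) (fun a => R.ι.app (.left a)) (fun a => R.weakEquivalence _)
        (fun b => R.ι.app (.right b)) (fun b => R.weakEquivalence _)
        (fun b => (R.ι.naturality (WalkingMulticospan.Hom.fst (J := spineShape m) b)).symm)
        (fun b => (R.ι.naturality (WalkingMulticospan.Hom.snd (J := spineShape m) b)).symm) φ hφ
      let f : WalkingMulticospan.left (J := spineShape m) b.succ ⟶ .right b :=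
        WalkingMulticospan.Hom.snd (J := spineShape m) b
      have : Epi f := ⟨fun _ _ _ => Subsingleton.elim _ _⟩
      exact R.fibrant.fibration_map f
    have hc : hl.lift ((Cone.postcompose R.ι).obj c) = ψ ≫ φ := by
      refine hR.hom_ext fun a => (hl.fac _ _).trans ?_
      refine Eq.trans ?_ (Category.assoc _ _ _).symm
      rw [hφ]
      exact ((hψ a).symm =≫ R.ι.app (.left a)).trans (Category.assoc _ _ _)
    rw [hc, weakEquivalence_postcomp_iff]
  constructor
  · rintro ⟨R, l, hl, h⟩
    exact (key R l hl).1 h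
  · intro h
    obtain ⟨R⟩ := nonempty_fibrantReplacement_constSpine t s m
    obtain ⟨L', p', h'⟩ := exists_isSpineLimit (E := fun a => R.diagram.obj (.left a))
      (V := fun b => R.diagram.obj (.right b))
      (fun b : Fin m => R.diagram.map (WalkingMulticospan.Hom.fst (J := spineShape m) b))
      (fun b : Fin m => R.diagram.map (WalkingMulticospan.Hom.snd (J := spineShape m) b))
    obtain ⟨l, ⟨hl⟩⟩ := h'.exists_isLimit
    exact ⟨R, l, hl, (key R l hl).2 h⟩

end

/-! ### Segal objects in terms of squares -/

lemma mkOfSucc_δ_last {m : ℕ} (i : Fin m) :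
    SimplexCategory.mkOfSucc i ≫ SimplexCategory.δ (Fin.last (m + 1)) =
      SimplexCategory.mkOfSucc i.castSucc := by
  ext j : 3
  fin_cases j
  · change (Fin.last (m + 1)).succAbove i.castSucc = _
    rw [Fin.succAbove_last]
    rfl
  · change (Fin.last (m + 1)).succAbove i.succ = _
    rw [Fin.succAbove_last]
    rfl

lemma mono_joinMap {x y : SimplexCategory} (f : x ⟶ y) [Mono f] : Mono (joinMap f) := by
  have hf := SimplexCategory.mono_iff_injective.1 (inferInstance : Mono f)
  rw [SimplexCategory.mono_iff_injective]
  intro a b hab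
  induction a using Fin.cases with
  | zero =>
    induction b using Fin.cases with
    | zero => rfl
    | succ b => exact absurd hab.symm (Fin.succ_ne_zero _)
  | succ a =>
    induction b using Fin.cases with
    | zero => exact absurd hab (Fin.succ_ne_zero _)
    | succ b => exact congrArg Fin.succ (hf (Fin.succ_injective _ hab))

section

variable {C : Type u} [Category.{v} C] [ModelCategory C]

/-- A simplicial object which is levelwise fibrant and sends monomorphisms of `Δ` to
fibrations. -/
structure IsMonoFibrant (X : SimplicialObject C) : Prop where
  isFibrant (n : SimplexCategory) : IsFibrant (X.obj (op n))
  fibration {a b : SimplexCategory} (f : a ⟶ b) [Mono f] : Fibration (X.map f.op)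

/-- The décalage `n ↦ X_{1+n}`. -/
abbrev decalage (X : SimplicialObject C) : SimplicialObject C := join.op ⋙ X

lemma IsMonoFibrant.decalage {X : SimplicialObject C} (hX : IsMonoFibrant X) :
    IsMonoFibrant (decalage X) where
  isFibrant n := hX.isFibrant _
  fibration f _ := by
    have := mono_joinMap f
    exact hX.fibration (joinMap f)

/-- The square comparing `X_{m+2}` to `X_{m+1} ×_{X_0} X_1` is a homotopy pullback. -/
def SegalSquare (X : SimplicialObject C) (m : ℕ) : Prop :=
  IsHoPullback (X.map (SimplexCategory.δ (Fin.last (m + 2))).op)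
    (X.map (SimplexCategory.mkOfSucc (Fin.last (m + 1))).op)
    (X.map (SimplexCategory.const (SimplexCategory.mk 0) (SimplexCategory.mk (m + 1))
      (Fin.last (m + 1))).op)
    (X.map (SimplexCategory.δ (n := 0) 1).op)

lemma segalMapIsWeakEquivalence_iff {X : SimplicialObject C} (hX : IsMonoFibrant X) {m : ℕ} {L : C}
    {p : Fin (m + 1) → (L ⟶ X.obj (op (SimplexCategory.mk 1)))}
    (h : IsSpineLimit (V := fun _ => X.obj (op (SimplexCategory.mk 0)))
      (fun _ => X.map (SimplexCategory.δ (n := 0) 0).op)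
      (fun _ => X.map (SimplexCategory.δ (n := 0) 1).op) p)
    (ψ : X.obj (op (SimplexCategory.mk (m + 1))) ⟶ L)
    (hψ : ∀ a, ψ ≫ p a = X.map (SimplexCategory.mkOfSucc (n := m + 1) a).op) :
    SegalMapIsWeakEquivalence X m ↔ WeakEquivalence ψ := by
  have := hX.isFibrant (SimplexCategory.mk 0)
  have := hX.isFibrant (SimplexCategory.mk 1)
  have := hX.fibration (SimplexCategory.δ (n := 0) 1)
  exact isHomotopyLimit_constSpine_iff (spineCone X m) h ψ hψ

lemma segalMapIsWeakEquivalence_zero {X : SimplicialObject C} (hX : IsMonoFibrant X) :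
    SegalMapIsWeakEquivalence X 0 := by
  rw [segalMapIsWeakEquivalence_iff hX (IsSpineLimit.of_zero _ _)
    (X.map (SimplexCategory.mkOfSucc (n := 1) 0).op)
    (Fin.cases (Category.comp_id _) (fun i => i.elim0))]
  have : SimplexCategory.mkOfSucc (n := 1) 0 = 𝟙 _ := by
    ext j : 3
    fin_cases j <;> rfl
  rw [this, op_id, X.map_id]
  infer_instance

/-- The longer spine limit is L ×_{X_0} X_1. As X_{m+1} ⟶ L is a weak equivalence, cogluing lets
X_{m+1} ×_{X_0} X_1 replace it, and the Segal map factors through that pullback. -/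
lemma segalMapIsWeakEquivalence_succ_iff {X : SimplicialObject C} (hX : IsMonoFibrant X) {m : ℕ}
    (h : SegalMapIsWeakEquivalence X m) :
    SegalMapIsWeakEquivalence X (m + 1) ↔ SegalSquare X m := by
  obtain ⟨L, p, hL⟩ := exists_isSpineLimit (m := m)
    (E := fun _ => X.obj (op (SimplexCategory.mk 1)))
    (V := fun _ => X.obj (op (SimplexCategory.mk 0)))
    (fun _ => X.map (SimplexCategory.δ (n := 0) 0).op)
    (fun _ => X.map (SimplexCategory.δ (n := 0) 1).op)
  have w : ∀ (n : ℕ) (b : Fin n), X.map (SimplexCategory.mkOfSucc (n := n + 1) b.castSucc).op ≫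
      X.map (SimplexCategory.δ (n := 0) 0).op = X.map (SimplexCategory.mkOfSucc b.succ).op ≫
        X.map (SimplexCategory.δ (n := 0) 1).op := fun n b => (spineCone X n).condition b
  obtain ⟨ψ, hψ⟩ := hL.exists_lift
    (fun a => X.map (SimplexCategory.mkOfSucc (n := m + 1) a).op) (w m)
  obtain ⟨L', a, b, hL'⟩ := exists_isPullback
    (p (Fin.last m) ≫ X.map (SimplexCategory.δ (n := 0) 0).op)
    (X.map (SimplexCategory.δ (n := 0) 1).op)
  have hS := IsSpineLimit.of_isPullback (m := m)
    (E := fun _ => X.obj (op (SimplexCategory.mk 1)))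
    (V := fun _ => X.obj (op (SimplexCategory.mk 0)))
    (t := fun _ => X.map (SimplexCategory.δ (n := 0) 0).op)
    (s := fun _ => X.map (SimplexCategory.δ (n := 0) 1).op) hL hL'
    (p' := fun i => Fin.lastCases (motive := fun _ => L' ⟶ X.obj (op (SimplexCategory.mk 1)))
      b (fun i => a ≫ p i) i) (fun i => Fin.lastCases_castSucc _) Fin.lastCases_last
  have hδ : ∀ i : Fin (m + 1), X.map (SimplexCategory.δ (Fin.last (m + 2))).op ≫
      X.map (SimplexCategory.mkOfSucc i).op = X.map (SimplexCategory.mkOfSucc i.castSucc).op :=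
    fun i => by rw [← X.map_comp, ← op_comp, mkOfSucc_δ_last]
  have hp : ψ ≫ p (Fin.last m) ≫ X.map (SimplexCategory.δ (n := 0) 0).op =
      X.map (SimplexCategory.const (SimplexCategory.mk 0) (SimplexCategory.mk (m + 1))
        (Fin.last (m + 1))).op := by
    rw [← Category.assoc, hψ, ← X.map_comp, ← op_comp, SimplexCategory.δ_zero_mkOfSucc]
    rfl
  let ψ' : X.obj (op (SimplexCategory.mk (m + 2))) ⟶ L' :=
    hL'.lift (X.map (SimplexCategory.δ (Fin.last (m + 2))).op ≫ ψ)
      (X.map (SimplexCategory.mkOfSucc (Fin.last (m + 1))).op) (by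
        rw [Category.assoc, ← Category.assoc ψ, hψ, ← Category.assoc, hδ]
        exact w (m + 1) (Fin.last m))
  have h₁ : WeakEquivalence ψ := (segalMapIsWeakEquivalence_iff hX hL ψ hψ).1 h
  rw [segalMapIsWeakEquivalence_iff hX hS ψ' (fun i => by
    induction i using Fin.lastCases with
    | last => rw [Fin.lastCases_last]; exact hL'.lift_snd _ _ _
    | cast i => rw [Fin.lastCases_castSucc, hL'.lift_fst_assoc, Category.assoc, hψ, hδ])]
  obtain ⟨R, c, d, hR⟩ := exists_isPullback
    (X.map (SimplexCategory.const (SimplexCategory.mk 0) (SimplexCategory.mk (m + 1))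
      (Fin.last (m + 1))).op) (X.map (SimplexCategory.δ (n := 0) 1).op)
  have := hX.isFibrant (SimplexCategory.mk 0)
  have := hX.isFibrant (SimplexCategory.mk 1)
  have := hX.isFibrant (SimplexCategory.mk (m + 1))
  have := hX.fibration (SimplexCategory.δ (n := 0) 1)
  have : IsFibrant L := hL.isFibrant (fun _ => inferInstance) (fun _ => inferInstance)
  let φ : R ⟶ L' := hL'.lift (c ≫ ψ) d (by rw [Category.assoc, hp, hR.w])
  have : WeakEquivalence φ := weakEquivalence_of_isPullback_of_isPullback hR hL' ψ (𝟙 _) (𝟙 _)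
    (by rw [hp, Category.comp_id]) (by simp) φ (hL'.lift_fst _ _ _) (by simp [φ])
  let χ : X.obj (op (SimplexCategory.mk (m + 2))) ⟶ R :=
    hR.lift (X.map (SimplexCategory.δ (Fin.last (m + 2))).op)
      (X.map (SimplexCategory.mkOfSucc (Fin.last (m + 1))).op) (by
        rw [← hp, ← Category.assoc ψ, hψ, ← Category.assoc, hδ]
        exact w (m + 1) (Fin.last m))
  have hχ : χ ≫ φ = ψ' := hL'.hom_ext (by simp [χ, φ, ψ']) (by simp [χ, φ, ψ'])
  rw [← hχ, weakEquivalence_postcomp_iff]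
  constructor
  · intro H
    exact ⟨R, c, d, χ, hR, by simp [χ], by simp [χ], H⟩
  · intro H
    exact H.weakEquivalence hR χ (by simp [χ]) (by simp [χ])

lemma forall_segalMapIsWeakEquivalence_iff {X : SimplicialObject C} (hX : IsMonoFibrant X) :
    (∀ m, SegalMapIsWeakEquivalence X m) ↔ ∀ m, SegalSquare X m := by
  constructor
  · intro h m
    exact (segalMapIsWeakEquivalence_succ_iff hX (h m)).1 (h (m + 1))
  · intro h m
    induction m with
    | zero => exact segalMapIsWeakEquivalence_zero hX
    | succ m ih => exact (segalMapIsWeakEquivalence_succ_iff hX ih).2 (h m)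

lemma joinMap_δ_last (m : ℕ) : joinMap (SimplexCategory.δ (Fin.last (m + 1))) =
    SimplexCategory.δ (Fin.last (m + 2)) := by
  ext j : 3
  induction j using Fin.cases with
  | zero => rfl
  | succ j =>
    change ((Fin.last (m + 1)).succAbove j).succ = (Fin.last (m + 2)).succAbove j.succ
    rw [Fin.succAbove_last, Fin.succAbove_last, Fin.succ_castSucc]

/-- In X_{m+3} ~ X_{m+2} ×_{X_0} X_1, the map to X_1 factors through X_2 via the face {0, m+2, m+3},
and the last vertex of X_{m+2} through the edge {0, m+2}. Cancelling X_2 ~ X_1 ×_{X_0} X_1 leaves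
X_{m+3} ~ X_{m+2} ×_{X_1} X_2. -/
lemma SegalSquare.decalage {X : SimplicialObject C} (hX : IsMonoFibrant X)
    (h : ∀ m, SegalSquare X m) (m : ℕ) : SegalSquare (decalage X) m := by
  have h₀ := h 0
  have h₁ := h (m + 1)
  have := hX.fibration (SimplexCategory.δ (n := 0) 1)
  have := hX.fibration (SimplexCategory.δ (n := 1) (Fin.last 2))
  have e₁ : SimplexCategory.mkOfSucc (Fin.last (m + 2)) =
      SimplexCategory.mkOfSucc (n := 2) (Fin.last 1) ≫
        joinMap (SimplexCategory.mkOfSucc (Fin.last (m + 1))) := by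
    ext j : 3
    fin_cases j <;> rfl
  have e₂ : SimplexCategory.const (SimplexCategory.mk 0) (SimplexCategory.mk (m + 2))
      (Fin.last (m + 2)) = SimplexCategory.const (SimplexCategory.mk 0) (SimplexCategory.mk 1)
      (Fin.last 1) ≫ joinMap (SimplexCategory.const (SimplexCategory.mk 0)
        (SimplexCategory.mk (m + 1)) (Fin.last (m + 1))) := by
    ext j : 3
    fin_cases j <;> rfl
  have e₃ : joinMap (SimplexCategory.δ (n := 0) 1) = SimplexCategory.δ (n := 1) (Fin.last 2) :=
    joinMap_δ_last 0
  have e₄ : joinMap (SimplexCategory.δ (Fin.last (m + 2))) =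
    SimplexCategory.δ (Fin.last (m + 3)) := joinMap_δ_last (m + 1)
  unfold SegalSquare at h₀ h₁
  rw [e₁, e₂, op_comp, op_comp, X.map_comp, X.map_comp] at h₁
  have h₂ := (IsHoPullback.paste_horiz_iff h₀.flip (by
    rw [← X.map_comp, ← X.map_comp, ← op_comp, ← op_comp, ← e₃, ← e₄]
    congr 2
    refine (join.map_comp _ _).symm.trans (Eq.trans ?_ (join.map_comp _ _))
    rw [SimplexCategory.δ_one_mkOfSucc]
    congr 1
    ext j : 3
    change _ = (Fin.last (m + 2)).succAbove (Fin.last (m + 1))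
    rw [Fin.succAbove_last]
    rfl)).1 h₁.flip
  rw [← e₃, ← e₄] at h₂
  exact h₂.flip

end

/-! ### Injectively fibrant preaugmented bisimplicial objects -/

instance (x y : SimplexCategory) : Finite (x ⟶ y) :=
  Finite.of_injective (fun f => (f.toOrderHom : Fin (x.len + 1) → Fin (y.len + 1)))
    fun _ _ h => SimplexCategory.Hom.ext _ _ (OrderHom.ext _ _ h)

instance (x y : SigmaCatᵒᵖ) : Finite (x ⟶ y) := by
  suffices ∀ a b : SigmaCat, Finite (a ⟶ b) from
    have := this y.unop x.unop
    Finite.of_injective Quiver.Hom.unop Quiver.Hom.unop_inj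
  rintro (a | _) (b | _)
  · exact (inferInstance : Finite ((a.1 ⟶ b.1) × (a.2 ⟶ b.2)))
  · exact (inferInstance : Finite PUnit.{1})
  · exact (inferInstance : Finite PEmpty.{1})
  · exact (inferInstance : Finite PUnit.{1})

/-- The added terminal object maps to no object of Δ × Δ, so it provides no new test maps. -/
lemma mono_incl_map {x y : SimplexCategory × SimplexCategory} (f : x ⟶ y) [Mono f.1] [Mono f.2] :
    Mono (WithTerminal.incl.map f) := by
  refine ⟨fun {z} g h w => ?_⟩
  rcases z with z | _
  · have w' : (show z ⟶ x from g) ≫ f = (show z ⟶ x from h) ≫ f := w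
    exact Prod.ext ((cancel_mono f.1).1 (congrArg Prod.fst w'))
      ((cancel_mono f.2).1 (congrArg Prod.snd w'))
  · exact (WithTerminal.false_of_from_star g).elim

lemma mono_of_zero {y : SimplexCategory} (f : SimplexCategory.mk 0 ⟶ y) : Mono f := by
  rw [SimplexCategory.mono_iff_injective]
  intro a b _
  exact Subsingleton.elim (α := Fin 1) a b

lemma mono_mkOfSucc {n : ℕ} (i : Fin n) : Mono (SimplexCategory.mkOfSucc i) := by
  rw [SimplexCategory.mono_iff_injective]
  have h : i.castSucc ≠ i.succ := (Fin.castSucc_lt_succ (i := i)).ne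
  intro a b hab
  fin_cases a <;> fin_cases b
  · rfl
  · exact absurd hab h
  · exact absurd hab h.symm
  · rfl

/-- The morphism of simplicial objects `Z_{•,r} ⟶ Z_{•,r'}` induced by `[r'] ⟶ [r]`. -/
def fixSndMap {C : Type u} [Category.{v} C] (Z : BisimplicialObject C) {r r' : ℕ}
    (g : SimplexCategory.mk r' ⟶ SimplexCategory.mk r) : fixSnd Z r ⟶ fixSnd Z r' where
  app n := Z.map (Quiver.Hom.op (Prod.mkHom (𝟙 n.unop) g))
  naturality a b f := by
    change Z.map _ ≫ Z.map _ = Z.map _ ≫ Z.map _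
    rw [← Z.map_comp, ← Z.map_comp]
    congr 1

lemma fixFst_pathBisimplicial {C : Type u} [Category.{v} C]
    (Z : BisimplicialObject C) (q : ℕ) :
    fixFst (pathBisimplicial Z) q = fixFst Z (q + 1) := by
  refine CategoryTheory.Functor.ext (fun n => rfl) (fun a b f => ?_)
  have : joinMap (𝟙 (SimplexCategory.mk q)) = 𝟙 _ := join.map_id _
  refine Eq.trans ?_ (((Category.id_comp _).trans (Category.comp_id _)).symm)
  change Z.map (Quiver.Hom.op (Prod.mkHom (joinMap (𝟙 (SimplexCategory.mk q))) f.unop)) = _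
  rw [this]
  rfl

section

variable {C : Type u} [Category.{v} C] [ModelCategory C] {Y : PreaugmentedBisimplicialObject C}

lemma IsInjectivelyFibrant.fibration_underlying_map (hfib : IsInjectivelyFibrant Y)
    {x y : SimplexCategory × SimplexCategory} (f : x ⟶ y) [Mono f.1] [Mono f.2] :
    Fibration ((underlying Y).map f.op) := by
  have := mono_incl_map f
  exact hfib.fibration_map (WithTerminal.incl.map f).op

lemma IsInjectivelyFibrant.isMonoFibrant (hfib : IsInjectivelyFibrant Y) (r : ℕ) :
    IsMonoFibrant (fixSnd (underlying Y) r) where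
  isFibrant n := hfib.isFibrant _
  fibration {a b} f _ := by
    let g : ((a, SimplexCategory.mk r) : SimplexCategory × SimplexCategory) ⟶
      (b, SimplexCategory.mk r) := Prod.mkHom f (𝟙 _)
    have : Mono g.1 := ‹_›
    have : Mono g.2 := (inferInstance : Mono (𝟙 (SimplexCategory.mk r)))
    exact hfib.fibration_underlying_map g

lemma SegalSquare.of_retract {X X' : SimplicialObject C} (i : X ⟶ X') (r : X' ⟶ X)
    (h : i ≫ r = 𝟙 X) {m : ℕ} (hX : SegalSquare X' m) : SegalSquare X m := by
  let ρ (n : SimplexCategoryᵒᵖ) : Retract (X.obj n) (X'.obj n) :=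
    { i := i.app n
      r := r.app n
      retract := by rw [← NatTrans.comp_app, h, NatTrans.id_app] }
  refine IsHoPullback.of_retract hX ?_ (ρ _) (ρ _) (ρ _) (ρ _) (i.naturality _).symm
    (i.naturality _).symm (i.naturality _).symm (i.naturality _).symm (r.naturality _).symm
    (r.naturality _).symm (r.naturality _).symm (r.naturality _).symm
  have := hX.w
  have hr : ∀ n, i.app n ≫ r.app n = 𝟙 _ := fun n => by rw [← NatTrans.comp_app, h]; rfl
  have key : ∀ {a b c : SimplexCategoryᵒᵖ} (f : a ⟶ b) (g : b ⟶ c),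
      X.map f ≫ X.map g = i.app a ≫ (X'.map f ≫ X'.map g) ≫ r.app c := by
    intro a b c f g
    rw [Category.assoc, r.naturality, reassoc_of% (i.naturality f).symm, reassoc_of% hr]
  rw [key, key, this]

end

/-! ### The initial path construction -/

/-- The last coface `(1, r) ⟶ (2, r)`, omitting `2` in the first component. -/
abbrev dLast (r : ℕ) : bi 1 r ⟶ bi 2 r :=
  Prod.mkHom (SimplexCategory.δ (Fin.last 2)) (𝟙 (SimplexCategory.mk r))

/-- The inner coface `(1, r) ⟶ (2, r)`, omitting `1` in the first component. -/
abbrev dMid (r : ℕ) : bi 1 r ⟶ bi 2 r :=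
  Prod.mkHom (SimplexCategory.δ 1) (𝟙 (SimplexCategory.mk r))

/-- The inclusion `(1, r) ⟶ (2, r)` of the last edge in the first component. -/
abbrev eLast (r : ℕ) : bi 1 r ⟶ bi 2 r :=
  Prod.mkHom (SimplexCategory.mkOfSucc (Fin.last 1)) (𝟙 (SimplexCategory.mk r))

section

variable {C : Type u} [Category.{v} C] [ModelCategory C]

lemma const_zero_eq : SimplexCategory.const (SimplexCategory.mk 0) (SimplexCategory.mk 1) 0 =
    SimplexCategory.δ (n := 0) 1 := by
  ext j : 3
  fin_cases j; rfl

lemma joinMap_const_zero :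
    joinMap (SimplexCategory.const (SimplexCategory.mk 0) (SimplexCategory.mk 1) 0) =
      SimplexCategory.δ (Fin.last 2) := by
  rw [const_zero_eq]
  exact joinMap_δ_last 0

lemma joinMap_const_last :
    joinMap (SimplexCategory.const (SimplexCategory.mk 0) (SimplexCategory.mk 1) (Fin.last 1)) =
      SimplexCategory.δ 1 := by
  ext j : 3
  fin_cases j <;> rfl

lemma segalSquare_fixSnd_iff (Z : BisimplicialObject C) (r : ℕ) :
    SegalSquare (fixSnd Z r) 0 ↔ IsHoPullback (Z.map (dLast r).op) (Z.map (eLast r).op)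
      (Z.map (tv 1 r).op) (Z.map (sv 1 r).op) := by
  have : sv 1 r = Prod.mkHom (SimplexCategory.δ (n := 0) 1) (𝟙 (SimplexCategory.mk r)) := by
    rw [← const_zero_eq]
  rw [this]
  rfl

lemma IsDoubleSegal.segalSquare {Z : BisimplicialObject C} (h : IsDoubleSegal Z) {r : ℕ}
    (hX : IsMonoFibrant (fixSnd Z (r + 1))) (m : ℕ) : SegalSquare (fixSnd Z (r + 1)) m :=
  (forall_segalMapIsWeakEquivalence_iff hX).1 (fun a => (h a r).2) m

/-- The degeneracy and a face make Z_{•,0} a retract of Z_{•,1}. This supplies the column 0 case,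
which `IsDoubleSegal` leaves out. -/
lemma SegalSquare.fixSnd_zero {Z : BisimplicialObject C} {m : ℕ}
    (h : SegalSquare (fixSnd Z 1) m) : SegalSquare (fixSnd Z 0) m := by
  refine SegalSquare.of_retract (fixSndMap Z (SimplexCategory.σ (n := 0) 0))
    (fixSndMap Z (SimplexCategory.δ (n := 0) 1)) ?_ h
  ext n
  change Z.map _ ≫ Z.map _ = 𝟙 _
  rw [← Z.map_comp, ← Z.map_id]
  exact congrArg (fun f => Z.map (Quiver.Hom.op f)) (Prod.ext (Category.comp_id _) (by
    ext j : 3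
    exact Subsingleton.elim (α := Fin 1) _ _))

variable {Y : PreaugmentedBisimplicialObject C}

/-- In the second direction row q of the path construction is row q + 1 of Y; in the first direction
each column is a décalage. -/
lemma IsDoubleSegal.initialPath (hfib : IsInjectivelyFibrant Y)
    (h : IsDoubleSegal (underlying Y)) : IsDoubleSegal (underlying (initialPath Y)) := by
  intro a b
  constructor
  · change SegalMapIsWeakEquivalence (fixFst (pathBisimplicial (underlying Y)) (a + 1)) b
    rw [fixFst_pathBisimplicial]
    exact (h (a + 1) b).1
  · have hX := hfib.isMonoFibrant (b + 1)
    exact (forall_segalMapIsWeakEquivalence_iff hX.decalage).2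
      (SegalSquare.decalage hX (h.segalSquare hX)) a

lemma isStable_iff (hfib : IsInjectivelyFibrant Y) : IsStable (underlying Y) ↔
    IsHoPullback ((underlying Y).map (sv 1 1).op) ((underlying Y).map (sh 1 1).op)
      ((underlying Y).map (sh 0 1).op) ((underlying Y).map (sv 1 0).op) ∧
    IsHoPullback ((underlying Y).map (th 1 1).op) ((underlying Y).map (tv 1 1).op)
      ((underlying Y).map (tv 1 0).op) ((underlying Y).map (th 0 1).op) := by
  have h₁ : Mono (sh 0 1).1 := inferInstanceAs (Mono (𝟙 _))
  have h₂ : Mono (sh 0 1).2 := mono_of_zero _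
  have h₃ : Mono (tv 1 0).1 := mono_of_zero _
  have h₄ : Mono (tv 1 0).2 := inferInstanceAs (Mono (𝟙 _))
  have := hfib.fibration_underlying_map (sh 0 1)
  have := hfib.fibration_underlying_map (tv 1 0)
  have (x : SimplexCategory × SimplexCategory) : IsFibrant ((underlying Y).obj (op x)) :=
    hfib.isFibrant _
  exact and_congr (isHomotopyLimit_iff_isHoPullback _) (isHomotopyLimit_iff_isHoPullback _)

end

/-- The edges {1, 2} and {0, 2} of [2] have the same final vertex. -/
lemma eLast_tv {C : Type u} [Category.{v} C] (Z : BisimplicialObject C) (r : ℕ) :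
    Z.map (eLast r).op ≫ Z.map (tv 1 r).op = Z.map (dMid r).op ≫ Z.map (tv 1 r).op := by
  rw [← Z.map_comp, ← Z.map_comp]
  exact congrArg (fun f => Z.map (Quiver.Hom.op f)) (Prod.ext (by
    ext j : 3
    fin_cases j; rfl) rfl)

/-! ### Stability squares one level up -/

section

variable {C : Type u} [Category.{v} C] [ModelCategory C]

/-- Pasting the Segal square of column 1 with source stability gives a rectangle that also factors
through the Segal square of column 0; cancelling the latter leaves the claim. -/
lemma isHoPullback_dLast_sh {Z : BisimplicialObject C} [∀ r, Fibration (Z.map (sv 1 r).op)]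
    [Fibration (Z.map (dLast 0).op)]
    (h₁ : SegalSquare (fixSnd Z 1) 0)
    (h : IsHoPullback (Z.map (sv 1 1).op) (Z.map (sh 1 1).op) (Z.map (sh 0 1).op)
      (Z.map (sv 1 0).op)) :
    IsHoPullback (Z.map (dLast 1).op) (Z.map (sh 2 1).op) (Z.map (sh 1 1).op)
      (Z.map (dLast 0).op) := by
  have S₁ := ((segalSquare_fixSnd_iff Z 1).1 h₁).flip
  have S₀ := ((segalSquare_fixSnd_iff Z 0).1 h₁.fixSnd_zero).flip
  have key := (IsHoPullback.paste_horiz_iff h.flip S₁.w).2 S₁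
  have e₁ : Z.map (eLast 1).op ≫ Z.map (sh 1 1).op = Z.map (sh 2 1).op ≫ Z.map (eLast 0).op := by
    rw [← Z.map_comp, ← Z.map_comp]
    rfl
  have e₂ : Z.map (tv 1 1).op ≫ Z.map (sh 0 1).op = Z.map (sh 1 1).op ≫ Z.map (tv 1 0).op := by
    rw [← Z.map_comp, ← Z.map_comp]
    rfl
  have e₃ : Z.map (sh 2 1).op ≫ Z.map (dLast 0).op = Z.map (dLast 1).op ≫ Z.map (sh 1 1).op := by
    rw [← Z.map_comp, ← Z.map_comp]
    rfl
  rw [e₁, e₂] at key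
  exact ((IsHoPullback.paste_horiz_iff S₀ e₃).1 key).flip

lemma isHoPullback_th_dMid {Z : BisimplicialObject C} [∀ r, Fibration (Z.map (tv 1 r).op)] [Fibration (Z.map (eLast 0).op)]
    [Fibration (Z.map (th 0 1).op)] [Fibration (Z.map (th 1 1).op)]
    (h₁ : SegalSquare (fixSnd Z 1) 0)
    (h : IsHoPullback (Z.map (th 1 1).op) (Z.map (tv 1 1).op) (Z.map (tv 1 0).op)
      (Z.map (th 0 1).op)) :
    IsHoPullback (Z.map (th 2 1).op) (Z.map (dMid 1).op) (Z.map (dMid 0).op)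
      (Z.map (th 1 1).op) := by
  have S₁ := (segalSquare_fixSnd_iff Z 1).1 h₁
  have S₀ := (segalSquare_fixSnd_iff Z 0).1 h₁.fixSnd_zero
  have key := (IsHoPullback.paste_horiz_iff h S₁.w).2 S₁
  have e₁ : Z.map (dLast 1).op ≫ Z.map (th 1 1).op = Z.map (th 2 1).op ≫ Z.map (dLast 0).op := by
    rw [← Z.map_comp, ← Z.map_comp]
    rfl
  have e₂ : Z.map (sv 1 1).op ≫ Z.map (th 0 1).op = Z.map (th 1 1).op ≫ Z.map (sv 1 0).op := by
    rw [← Z.map_comp, ← Z.map_comp]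
    rfl
  have e₃ : Z.map (th 2 1).op ≫ Z.map (eLast 0).op = Z.map (eLast 1).op ≫ Z.map (th 1 1).op := by
    rw [← Z.map_comp, ← Z.map_comp]
    rfl
  have e₄ : Z.map (th 2 1).op ≫ Z.map (dMid 0).op = Z.map (dMid 1).op ≫ Z.map (th 1 1).op := by
    rw [← Z.map_comp, ← Z.map_comp]
    rfl
  rw [e₁, e₂] at key
  have E := (IsHoPullback.paste_horiz_iff S₀ e₃).1 key
  -- E is the square for the edge {1, 2}. Extended by target stability to the final vertex, its
  -- outer rectangle is equally that of {0, 2}, so cancelling the same stability square yields the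
  -- square for the inner face.
  have key' := (IsHoPullback.paste_vert_iff h e₃).2 E
  rw [eLast_tv, eLast_tv] at key'
  exact (IsHoPullback.paste_vert_iff h e₄).1 key'

variable {Y : PreaugmentedBisimplicialObject C}

lemma IsInjectivelyFibrant.fibration_mkHom (hfib : IsInjectivelyFibrant Y)
    {x y x' y' : SimplexCategory} (f : x ⟶ y) (g : x' ⟶ y') [Mono f] [Mono g] :
    Fibration ((underlying Y).map (Quiver.Hom.op (Prod.mkHom f g))) :=
  have : Mono (Prod.mkHom f g).1 := ‹Mono f›
  have : Mono (Prod.mkHom f g).2 := ‹Mono g›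
  hfib.fibration_underlying_map (Prod.mkHom f g)

section

variable (hfib : IsInjectivelyFibrant Y)
include hfib

lemma IsInjectivelyFibrant.fibration_sh (k l : ℕ) : Fibration ((underlying Y).map (sh k l).op) :=
  have := mono_of_zero (SimplexCategory.const (.mk 0) (.mk l) 0)
  hfib.fibration_mkHom _ _

lemma IsInjectivelyFibrant.fibration_th (k l : ℕ) : Fibration ((underlying Y).map (th k l).op) :=
  have := mono_of_zero (SimplexCategory.const (.mk 0) (.mk l) (Fin.last l))
  hfib.fibration_mkHom _ _

lemma IsInjectivelyFibrant.fibration_sv (k l : ℕ) : Fibration ((underlying Y).map (sv k l).op) :=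
  have := mono_of_zero (SimplexCategory.const (.mk 0) (.mk k) 0)
  hfib.fibration_mkHom _ _

lemma IsInjectivelyFibrant.fibration_tv (k l : ℕ) : Fibration ((underlying Y).map (tv k l).op) :=
  have := mono_of_zero (SimplexCategory.const (.mk 0) (.mk k) (Fin.last k))
  hfib.fibration_mkHom _ _

lemma IsInjectivelyFibrant.fibration_eLast (r : ℕ) : Fibration ((underlying Y).map (eLast r).op) :=
  have := mono_mkOfSucc (Fin.last 1)
  hfib.fibration_mkHom _ _

end

/-! ### Structure maps of the path construction -/

lemma initialPath_map_sv (Y : PreaugmentedBisimplicialObject C) (r : ℕ) :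
    (underlying (initialPath Y)).map (sv 1 r).op =
    (underlying Y).map (dLast r).op :=
  congrArg (fun f : SimplexCategory.mk 1 ⟶ SimplexCategory.mk 2 =>
    (underlying Y).map (Quiver.Hom.op (Prod.mkHom f (𝟙 (SimplexCategory.mk r)))))
    joinMap_const_zero

lemma initialPath_map_tv (Y : PreaugmentedBisimplicialObject C) (r : ℕ) :
    (underlying (initialPath Y)).map (tv 1 r).op =
    (underlying Y).map (dMid r).op :=
  congrArg (fun f : SimplexCategory.mk 1 ⟶ SimplexCategory.mk 2 =>
    (underlying Y).map (Quiver.Hom.op (Prod.mkHom f (𝟙 (SimplexCategory.mk r)))))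
    joinMap_const_last

lemma initialPath_map_sh (Y : PreaugmentedBisimplicialObject C) (k : ℕ) :
    (underlying (initialPath Y)).map (sh k 1).op =
    (underlying Y).map (sh (k + 1) 1).op :=
  congrArg (fun f : SimplexCategory.mk (k + 1) ⟶ SimplexCategory.mk (k + 1) =>
    (underlying Y).map (Quiver.Hom.op (Prod.mkHom f
      (SimplexCategory.const (SimplexCategory.mk 0) (SimplexCategory.mk 1) 0))))
    (join.map_id (SimplexCategory.mk k))

lemma initialPath_map_th (Y : PreaugmentedBisimplicialObject C) (k : ℕ) :
    (underlying (initialPath Y)).map (th k 1).op =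
    (underlying Y).map (th (k + 1) 1).op :=
  congrArg (fun f : SimplexCategory.mk (k + 1) ⟶ SimplexCategory.mk (k + 1) =>
    (underlying Y).map (Quiver.Hom.op (Prod.mkHom f
      (SimplexCategory.const (SimplexCategory.mk 0) (SimplexCategory.mk 1) (Fin.last 1)))))
    (join.map_id (SimplexCategory.mk k))

lemma augmentation_initialPath (Y : PreaugmentedBisimplicialObject C) :
    augmentation (initialPath Y) = pathAugmentation Y := by
  have : toZero (bi 0 0) = 𝟙 _ := Prod.ext (by ext j : 3; exact Subsingleton.elim (α := Fin 1) _ _)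
    (by ext j : 3; exact Subsingleton.elim (α := Fin 1) _ _)
  change pathAugmentation Y ≫ (pathBisimplicial (underlying Y)).map (toZero (bi 0 0)).op = _
  rw [this, op_id, CategoryTheory.Functor.map_id, Category.comp_id]

/-! ### Stability and augmentation of the path construction -/

lemma IsStable.initialPath (hfib : IsInjectivelyFibrant Y) (hd : IsDoubleSegal (underlying Y))
    (h : IsStable (underlying Y)) : IsStable (underlying (initialPath Y)) := by
  have hS := hd.segalSquare (hfib.isMonoFibrant 1) 0
  obtain ⟨hs, ht⟩ := (isStable_iff hfib).1 h
  have := hfib.fibration_sv 1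
  have := hfib.fibration_tv 1
  have := hfib.fibration_th 0 1
  have := hfib.fibration_th 1 1
  have := hfib.fibration_sh 1 1
  have := hfib.fibration_eLast 0
  have : Fibration ((underlying Y).map (dLast 0).op) := hfib.fibration_mkHom _ _
  have : Fibration ((underlying Y).map (dMid 0).op) := hfib.fibration_mkHom _ _
  have (x : SimplexCategory × SimplexCategory) : IsFibrant ((underlying Y).obj (op x)) :=
    hfib.isFibrant _
  have f₁ : Fibration ((underlying (DoubleSegal.initialPath Y)).map (sh 0 1).op) := by
    rw [initialPath_map_sh]; exact hfib.fibration_sh 1 1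
  have f₂ : Fibration ((underlying (DoubleSegal.initialPath Y)).map (tv 1 0).op) := by
    rw [initialPath_map_tv]; exact hfib.fibration_mkHom _ _
  have (x : SimplexCategory × SimplexCategory) :
    IsFibrant ((underlying (DoubleSegal.initialPath Y)).obj (op x)) := hfib.isFibrant _
  refine ⟨(isHomotopyLimit_iff_isHoPullback _).2 ?_, (isHomotopyLimit_iff_isHoPullback _).2 ?_⟩
  · change IsHoPullback ((underlying (DoubleSegal.initialPath Y)).map (sv 1 1).op) ((underlying (DoubleSegal.initialPath Y)).map (sh 1 1).op) _ _
    rw [initialPath_map_sv, initialPath_map_sv, initialPath_map_sh, initialPath_map_sh]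
    exact isHoPullback_dLast_sh hS hs
  · change IsHoPullback ((underlying (DoubleSegal.initialPath Y)).map (th 1 1).op) ((underlying (DoubleSegal.initialPath Y)).map (tv 1 1).op) _ _
    rw [initialPath_map_tv, initialPath_map_tv, initialPath_map_th, initialPath_map_th]
    exact isHoPullback_th_dMid hS ht

lemma IsAugmented.initialPath (hfib : IsInjectivelyFibrant Y) (hd : IsDoubleSegal (underlying Y))
    (h : IsStable (underlying Y)) (ha : IsAugmented Y) : IsAugmented (initialPath Y) := by
  have hS := hd.segalSquare (hfib.isMonoFibrant 1) 0
  have S₀ := (segalSquare_fixSnd_iff (underlying Y) 0).1 hS.fixSnd_zero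
  obtain ⟨hs, ht⟩ := (isStable_iff hfib).1 h
  have := hfib.fibration_sv 1
  have := hfib.fibration_tv 1
  have := hfib.fibration_th 0 1
  have := hfib.fibration_sh 0 1
  have := hfib.fibration_sh 1 1
  have := hfib.fibration_eLast 0
  have : Fibration ((underlying Y).map (dMid 0).op) := hfib.fibration_mkHom _ _
  have (x : SigmaCatᵒᵖ) : IsFibrant (Y.obj x) := hfib.isFibrant _
  have (x : SimplexCategory × SimplexCategory) : IsFibrant ((underlying Y).obj (op x)) :=
    hfib.isFibrant _
  have hE : IsPullback (pullback.fst _ _) (pullback.snd _ _) ((underlying Y).map (tv 1 0).op)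
    (augmentation Y) := IsPullback.of_hasPullback _ _
  obtain ⟨E', p', q', hE'⟩ :=
    exists_isPullback ((underlying Y).map (sh 0 1).op) (augmentation Y)
  have hFE := fibration_fst_of_isPullback hE.flip
  have hFE' := fibration_fst_of_isPullback hE'.flip
  have iE : IsFibrant (pathMinusOne Y) := isFibrant_of_fibration (pullback.snd _ _)
  have iE' : IsFibrant E' := isFibrant_of_fibration q'
  have a₁ := (projectionThenIsWeakEquivalence_iff hE).1 ha.1
  have a₂ := (projectionThenIsWeakEquivalence_iff hE').1 ha.2
  have iP (x : SimplexCategory × SimplexCategory) :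
    IsFibrant ((underlying (DoubleSegal.initialPath Y)).obj (op x)) := hfib.isFibrant _
  have iM : IsFibrant (minusOne (DoubleSegal.initialPath Y)) := iE
  constructor
  · have f : Fibration ((underlying (DoubleSegal.initialPath Y)).map (tv 1 0).op) := by
      rw [initialPath_map_tv]; exact hfib.fibration_mkHom _ _
    obtain ⟨K, k, l, hK⟩ := exists_isPullback
      ((underlying (DoubleSegal.initialPath Y)).map (tv 1 0).op)
      (augmentation (DoubleSegal.initialPath Y))
    rw [projectionThenIsWeakEquivalence_iff hK, initialPath_map_sv]
    rw [initialPath_map_tv, augmentation_initialPath] at hK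
    -- Here U = Y_{2,0}, with u₁, u₂, u₃ restricting to the edges {0, 2}, {1, 2}, {0, 1}. As {0, 2}
    -- and {1, 2} share their target, both m and t are tᵛ and `hE` serves twice.
    have := weakEquivalence_fst_comp_of_isHoPullback S₀ (eLast_tv _ 0).symm hE hE hK
    exact this
  · have f : Fibration ((underlying (DoubleSegal.initialPath Y)).map (sh 0 1).op) := by
      rw [initialPath_map_sh]; exact hfib.fibration_sh 1 1
    obtain ⟨K, k, l, hK⟩ := exists_isPullback
      ((underlying (DoubleSegal.initialPath Y)).map (sh 0 1).op)
      (augmentation (DoubleSegal.initialPath Y))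
    rw [projectionThenIsWeakEquivalence_iff hK, initialPath_map_th]
    rw [initialPath_map_sh, augmentation_initialPath] at hK
    have hw : (underlying Y).map (sh 1 1).op ≫ (underlying Y).map (tv 1 0).op =
        (underlying Y).map (tv 1 1).op ≫ (underlying Y).map (sh 0 1).op := by
      rw [← Functor.map_comp, ← Functor.map_comp]
      rfl
    -- Here U = Y_{1,1}: target stability plays the role of the Segal square, and the equivalence
    -- being base changed is the second augmentation condition of Y.
    have := weakEquivalence_fst_comp_of_isHoPullback ht hw hE hE' hK
    exact this

end

end DoubleSegal

theorem mainTheorem10 {C : Type u} [Category.{v} C] [ModelCategory C]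
    [DoubleSegal.IsCombinatorial.{w} C]
    (Y : DoubleSegal.PreaugmentedBisimplicialObject C)
    (hfib : DoubleSegal.IsInjectivelyFibrant Y)
    (hY : DoubleSegal.IsAugmentedStableDoubleSegal Y) :
    DoubleSegal.IsAugmentedStableDoubleSegal (DoubleSegal.initialPath Y) where
  doubleSegal := hY.doubleSegal.initialPath hfib
  stable := hY.stable.initialPath hfib hY.doubleSegal
  augmented := hY.augmented.initialPath hfib hY.doubleSegal hY.stable
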